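/- For a closed convex set $C\subset\mathbb{R}^n$, a face of $C$ is a nonempty convex subset $F\subseteq C$ such that $\alpha x+(1-\alpha)y\in F$ with $x,y\in C$, $\alpha\in(0,1)$ implies $x,y\in F$. A face is exposed if there are $y\in\mathbb{R}^n$ and $d\in\mathbb{R}$ with $\langle y,x\rangle\le d$ for all $x\in C$, with equality exactly when $x\in F$ (so $C$ is an exposed face of itself); $C$ is facially exposed if all its faces are exposed. A closed convex cone $K$ (containing $0$) is nice if $K^*+F^\perp$ is closed for every face $F$ of $K$, where $K^*=\{y \mid \langle x,y\rangle\ge 0\ \forall x\in K\}$ and $F^\perp$ is the orthogonal complement of $\operatorname{span}F$. For $t\in[0,\pi/4]$ let $$\gamma_1(t)=(0,-\sin t,\cos t-1),\quad \gamma_2(t)=(0,\cos t-1,-\sin t),$$ $$\gamma_3(t)=(-\sin t,1-\cos t,0),\quad \gamma_4(t)=(\cos t-1,\sin t,0),$$ and write $\gamma_i$ also for the arc $\gamma_i([0,\pi/4])\subset\mathbb{R}^3$. Let $C=\operatorname{co}(\gamma_1\cup\gamma_2\cup\gamma_3\cup\gamma_4)$, $c=(\tfrac12,0,\tfrac12)$,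 $C'=2C+c$, $K=\operatorname{cone}(\{1\}\times C')\subset\mathbb{R}^4$ and $F=\operatorname{cone}\bigl(\{1\}\times(2\operatorname{co}(\gamma_3\cup\gamma_4)+c)\bigr)$, where $\operatorname{co}$ and $\operatorname{cone}$ denote the convex hull and the convex conic hull (containing $0$). Theorem. $K$ is a closed, facially exposed convex cone, $F$ is a face of $K$, and the set $K^*+F^\perp$ is not closed; hence $K$ is not nice. In particular, Pataki's conjecture that every facially exposed closed convex cone in a Euclidean space $\mathbb{R}^n$ is nice is false. -/

import Mathlib

open scoped Pointwise

noncomputable section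

namespace PatakiCounterexample

/-- `ℝⁿ` with the Euclidean inner product. -/
abbrev Eucl (n : ℕ) : Type := EuclideanSpace ℝ (Fin n)

/-- `F` is a face of the convex set `C`: a nonempty convex subset of `C` such that whenever a point
`α x + (1 - α) y` with `x, y ∈ C`, `0 < α < 1` lies in `F`, both `x` and `y` lie in `F`. -/
structure IsFace {n : ℕ} (F C : Set (Eucl n)) : Prop where
  nonempty : F.Nonempty
  convex : Convex ℝ F
  isExtreme : IsExtreme ℝ C F

/-- Every face of `C` is the intersection of `C` with a supporting hyperplane (`C` itself being
exposed by the zero functional). Faces are nonempty, so the convention of `IsExposed` for the empty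
set plays no role. -/
def IsFaciallyExposed {n : ℕ} (C : Set (Eucl n)) : Prop :=
  ∀ F : Set (Eucl n), IsFace F C → IsExposed ℝ C F

/-- The Minkowski sum `K* + F^⊥` of the dual cone `K* = {y | ∀ x ∈ K, 0 ≤ ⟪x, y⟫}` and the
orthogonal complement of the linear span of `F`. -/
def dualAddPerp {n : ℕ} (K F : Set (Eucl n)) : Set (Eucl n) :=
  (ProperCone.innerDual K : Set (Eucl n)) + ((Submodule.span ℝ F)ᗮ : Set (Eucl n))

/-- `K` is nice: `K* + F^⊥` is closed for every face `F` of `K`. -/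
def IsNice {n : ℕ} (K : Set (Eucl n)) : Prop :=
  ∀ F : Set (Eucl n), IsFace F K → IsClosed (dualAddPerp K F)

/-- The first arc, parametrized by `t ∈ [0, π/4]`. -/
def γ₁ (t : ℝ) : Eucl 3 := !₂[0, -Real.sin t, Real.cos t - 1]

/-- The second arc. -/
def γ₂ (t : ℝ) : Eucl 3 := !₂[0, Real.cos t - 1, -Real.sin t]

/-- The third arc. -/
def γ₃ (t : ℝ) : Eucl 3 := !₂[-Real.sin t, 1 - Real.cos t, 0]

/-- The fourth arc. -/
def γ₄ (t : ℝ) : Eucl 3 := !₂[Real.cos t - 1, Real.sin t, 0]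

/-- The trace of a curve over the parameter interval `[0, π/4]`. -/
def arc (γ : ℝ → Eucl 3) : Set (Eucl 3) := γ '' Set.Icc 0 (Real.pi / 4)

/-- `C`, the convex hull of the four arcs. -/
def setC : Set (Eucl 3) := convexHull ℝ (arc γ₁ ∪ arc γ₂ ∪ arc γ₃ ∪ arc γ₄)

/-- The set `co {γ₃, γ₄}`. -/
def baseC : Set (Eucl 3) := convexHull ℝ (arc γ₃ ∪ arc γ₄)

/-- The affine map `x ↦ 2 x + c` with `c = (1/2, 0, 1/2)`. -/
def dilate (x : Eucl 3) : Eucl 3 := (2 : ℝ) • x + !₂[1 / 2, 0, 1 / 2]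

/-- The embedding `x ↦ (1, x)` of `ℝ³` into `ℝ⁴`. -/
def lift (x : Eucl 3) : Eucl 4 := !₂[1, x 0, x 1, x 2]

/-- `cone ({1} × S)` in `ℝ⁴`, for `S ⊆ ℝ³`. -/
def homogenization (S : Set (Eucl 3)) : PointedCone ℝ (Eucl 4) :=
  PointedCone.hull ℝ (lift '' S)

/-- `K = cone ({1} × C')` with `C' = 2 C + c`. -/
def coneK : PointedCone ℝ (Eucl 4) := homogenization (dilate '' setC)

/-- `F = cone ({1} × (2 co {γ₃, γ₄} + c))`. -/
def faceF : PointedCone ℝ (Eucl 4) := homogenization (dilate '' baseC)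

end PatakiCounterexample

end

noncomputable section

namespace PatakiCounterexample

/-! ### Convex hulls of compact sets -/

/-! Up to an affine change of coordinates the base of `K` is the hull of four circular arcs issuing
from the origin, two in the plane x = 0 and two in the plane z = 0. Supporting hyperplanes of `K`
become affine functionals `val m a b c` nonnegative on the arcs (`inner_vec_gen`).

Niceness fails because of a tangency at the origin. The coordinate y is nonnegative on the base of
`F`, but the first arc leaves the origin in the direction -y, tangentially to the plane z = 0. An
element of K* agreeing with y on `F` would take the values -sin t + c (1 - cos t) on that arc, a
linear loss against a quadratic gain, negative for small t > 0 (`notMem_dualAddPerp`). Adding any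
constant δ > 0 to y removes the obstruction, with c of order 1/δ (`mem_dualAddPerp`). So y is a
limit of elements of K* + F^⊥ outside that set.

For facial exposedness, a face is generated by the generators it contains (`face_eq_hull_inter`), so
it suffices that its arc points form the zero set of a functional nonnegative on the arcs
(`IsZeroSet`). A proper face lies on a supporting hyperplane (`exists_supporting_of_face_ne`). By
`zeros_subset` the zeros of such a functional are at most two points, or lie among three arc ends,
or lie in one of the two planes. Points and pairs of ends have explicit functionals. A face inside a
plane is the whole planar cone or has a second supporting functional within that plane, which leaves
at most one point or the two ends (`isZeroSet_of_subset_planar`). The involution `swap` exchanges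
the planes and halves the work. -/

theorem isCompact_convexHull_of_finiteDimensional {V : Type*} [NormedAddCommGroup V]
    [NormedSpace ℝ V] [FiniteDimensional ℝ V] {A : Set V} (hA : IsCompact A) :
    IsCompact (convexHull ℝ A) := by
  -- By Carathéodory's theorem `d` points suffice, so the hull is the image under `Φ` of a product
  -- of compact sets.
  let d := Module.finrank ℝ V + 1
  let Φ : (Fin d → ℝ) × (Fin d → V) → V := fun p => ∑ i, p.1 i • p.2 i
  have hΦ : Continuous Φ := by fun_prop
  have hcomp : IsCompact (stdSimplex ℝ (Fin d) ×ˢ Set.univ.pi fun _ : Fin d => A) :=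
    (isCompact_stdSimplex ℝ (Fin d)).prod (isCompact_univ_pi fun _ => hA)
  convert hcomp.image hΦ using 1
  apply Set.Subset.antisymm
  · intro x hx
    obtain ⟨ι, _, z, w, hz, hind, hw, hw1, rfl⟩ := eq_pos_convex_span_of_mem_convexHull hx
    have hcard : Fintype.card ι ≤ Fintype.card (Fin d) := by
      rw [Fintype.card_fin]
      exact hind.card_le_finrank_succ.trans
        (Nat.succ_le_succ (Submodule.finrank_le _))
    obtain ⟨e⟩ := Function.Embedding.nonempty_of_card_le hcard
    obtain ⟨a, ha⟩ := convexHull_nonempty_iff.1 ⟨_, hx⟩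
    -- When fewer than `d` points occur, the empty slots get weight 0 and the filler point `a`.
    refine ⟨(Function.extend e w 0, Function.extend e z fun _ => a), ⟨⟨fun i => ?_, ?_⟩, ?_⟩, ?_⟩
    · by_cases hi : ∃ j, e j = i
      · obtain ⟨j, rfl⟩ := hi
        simpa [e.injective.extend_apply] using (hw j).le
      · simp [Function.extend_apply' _ _ _ hi]
    · rw [← hw1]
      refine (Fintype.sum_of_injective e e.injective _ _ (fun i hi => ?_) fun i => ?_).symm
      · simp [Function.extend_apply' _ _ _ hi]
      · simp [e.injective.extend_apply]
    · intro i _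
      by_cases hi : ∃ j, e j = i
      · obtain ⟨j, rfl⟩ := hi
        simpa [e.injective.extend_apply] using hz ⟨j, rfl⟩
      · simpa [Function.extend_apply' _ _ _ hi] using ha
    · refine (Fintype.sum_of_injective e e.injective _ _ (fun i hi => ?_) fun i => ?_).symm
      · simp [Function.extend_apply' _ _ _ hi]
      · simp [e.injective.extend_apply]
  · rintro _ ⟨⟨w, z⟩, ⟨hw, hz⟩, rfl⟩
    exact (convex_convexHull ℝ A).sum_mem (fun i _ => hw.1 i) hw.2
      fun i _ => subset_convexHull ℝ A (hz i trivial)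

/-! ### Faces of convex cones -/

section Faces

variable {V : Type*} [NormedAddCommGroup V] [InnerProductSpace ℝ V]

theorem smul_mem_pointedCone (K : PointedCone ℝ V) {t : ℝ} (ht : 0 ≤ t) {x : V} (hx : x ∈ K) :
    t • x ∈ K := K.smul_mem ht hx

theorem zero_mem_of_isExtreme {K : PointedCone ℝ V} {E : Set V} (hE : IsExtreme ℝ (K : Set V) E)
    (hne : E.Nonempty) : (0 : V) ∈ E := by
  obtain ⟨x, hx⟩ := hne
  have hxK := hE.subset hx
  refine hE.left_mem_of_mem_openSegment K.zero_mem
    (smul_mem_pointedCone K (by norm_num : (0 : ℝ) ≤ 2) hxK) hx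
    ⟨1 / 2, 1 / 2, by norm_num, by norm_num, by norm_num, ?_⟩
  rw [smul_zero, zero_add, smul_smul]; norm_num

/-- For `t < 1` the point `x` is the midpoint of `t • x` and `(2 - t) • x`; for `t > 1` it lies
between `t • x` and the apex. -/
theorem smul_mem_of_isExtreme {K : PointedCone ℝ V} {E : Set V}
    (hE : IsExtreme ℝ (K : Set V) E) {x : V} (hx : x ∈ E) {t : ℝ} (ht : 0 ≤ t) : t • x ∈ E := by
  have hxK := hE.subset hx
  rcases ht.eq_or_lt with rfl | ht
  · simpa using zero_mem_of_isExtreme hE ⟨x, hx⟩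
  rcases eq_or_ne t 1 with rfl | h1
  · simpa using hx
  rcases lt_or_gt_of_ne h1 with h1 | h1
  · refine hE.left_mem_of_mem_openSegment (smul_mem_pointedCone K ht.le hxK)
      (smul_mem_pointedCone K (by linarith : 0 ≤ 2 - t) hxK) hx
      ⟨1 / 2, 1 / 2, by norm_num, by norm_num, by norm_num, ?_⟩
    rw [smul_smul, smul_smul, ← add_smul]
    ring_nf; simp
  · refine hE.left_mem_of_mem_openSegment (smul_mem_pointedCone K ht.le hxK) K.zero_mem hx
      ⟨t⁻¹, 1 - t⁻¹, by positivity, by linarith [inv_lt_one_of_one_lt₀ h1], by ring, ?_⟩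
    rw [smul_zero, add_zero, smul_smul, inv_mul_cancel₀ ht.ne', one_smul]

theorem left_mem_of_add_mem_isExtreme {K : PointedCone ℝ V} {E : Set V}
    (hE : IsExtreme ℝ (K : Set V) E) {x y : V} (hx : x ∈ K) (hy : y ∈ K) (h : x + y ∈ E) :
    x ∈ E := by
  have h2 : (2 : ℝ) • x ∈ E := by
    refine hE.left_mem_of_mem_openSegment (smul_mem_pointedCone K (by norm_num) hx)
      (smul_mem_pointedCone K (by norm_num : (0 : ℝ) ≤ 2) hy) h
      ⟨1 / 2, 1 / 2, by norm_num, by norm_num, by norm_num, ?_⟩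
    rw [smul_smul, smul_smul]; norm_num
  have := smul_mem_of_isExtreme hE h2 (by norm_num : (0 : ℝ) ≤ 1 / 2)
  rw [smul_smul] at this
  norm_num at this
  exact this

theorem add_mem_of_isExtreme {K : PointedCone ℝ V} {E : Set V}
    (hE : IsExtreme ℝ (K : Set V) E) (hc : Convex ℝ E) {x y : V} (hx : x ∈ E) (hy : y ∈ E) :
    x + y ∈ E := by
  have := smul_mem_of_isExtreme hE (hc hx hy (by norm_num : (0 : ℝ) ≤ 1 / 2)
    (by norm_num : (0 : ℝ) ≤ 1 / 2) (by norm_num)) (by norm_num : (0 : ℝ) ≤ 2)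
  simpa [smul_smul] using this

/-- A face of a convex cone is generated by the generators it contains. -/
theorem face_eq_hull_inter {G E : Set V}
    (hE : IsExtreme ℝ (PointedCone.hull ℝ G : Set V) E) (hne : E.Nonempty) (hc : Convex ℝ E) :
    E = (PointedCone.hull ℝ (G ∩ E) : Set V) := by
  apply Set.Subset.antisymm
  · have key : ∀ x ∈ PointedCone.hull ℝ G, x ∈ E → x ∈ PointedCone.hull ℝ (G ∩ E) := by
      intro x hx
      induction hx using Submodule.span_induction with
      | mem x h => exact fun hxE => Submodule.subset_span ⟨h, hxE⟩
      | zero => exact fun _ => zero_mem _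
      | add x y hx hy ihx ihy =>
        intro h
        exact add_mem (ihx (left_mem_of_add_mem_isExtreme hE hx hy h))
          (ihy (left_mem_of_add_mem_isExtreme hE hy hx (add_comm x y ▸ h)))
      | smul t x hx ih =>
        intro h
        rcases eq_or_ne t 0 with rfl | ht
        · simp
        · refine Submodule.smul_mem _ _ (ih ?_)
          have := smul_mem_of_isExtreme hE h (t⁻¹).2
          have h' : ((t⁻¹ : {c : ℝ // 0 ≤ c}) : ℝ) • t • x = x := by
            have ht' : (t : ℝ) ≠ 0 := fun h => ht (Subtype.ext h)
            change (t : ℝ)⁻¹ • (t : ℝ) • x = x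
            rw [smul_smul, inv_mul_cancel₀ ht', one_smul]
          rwa [h'] at this
    exact fun x hx => key x (hE.subset hx) hx
  · intro x hx
    induction hx using Submodule.span_induction with
    | mem x h => exact h.2
    | zero => exact zero_mem_of_isExtreme hE hne
    | add x y _ _ ihx ihy => exact add_mem_of_isExtreme hE hc ihx ihy
    | smul t x _ ih => exact smul_mem_of_isExtreme hE ih t.2

theorem inner_nonneg_of_mem_hull {G : Set V} {v : V} (hv : ∀ g ∈ G, 0 ≤ inner ℝ v g) {x : V}
    (hx : x ∈ PointedCone.hull ℝ G) : 0 ≤ inner ℝ v x := by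
  induction hx using Submodule.span_induction with
  | mem x h => exact hv x h
  | zero => simp
  | add x y _ _ ihx ihy => rw [inner_add_right]; positivity
  | smul t x _ ih =>
    change 0 ≤ inner ℝ v ((t : ℝ) • x)
    rw [inner_smul_right]
    exact mul_nonneg t.2 ih

/-- A functional nonnegative on a cone is minimal exactly where it vanishes, since the apex has
value 0. `IsExposed` speaks of maximizers, hence the sign in the proof. -/
theorem isExposed_inner_eq_zero {G : Set V} {v : V} (hv : ∀ g ∈ G, 0 ≤ inner ℝ v g) :
    IsExposed ℝ (PointedCone.hull ℝ G : Set V)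
      {x | x ∈ PointedCone.hull ℝ G ∧ inner ℝ v x = 0} := by
  intro _
  refine ⟨-(innerSL ℝ v), Set.ext fun x => ?_⟩
  simp only [Set.mem_ofPred_eq, SetLike.mem_coe, neg_apply, innerSL_apply_apply,
    neg_le_neg_iff]
  refine and_congr_right fun hx => ⟨fun h y hy => h ▸ inner_nonneg_of_mem_hull hv hy, fun h => ?_⟩
  exact le_antisymm (by simpa using h 0 (zero_mem _)) (inner_nonneg_of_mem_hull hv hx)

theorem zero_set_eq_hull {G : Set V} {v : V} (hv : ∀ g ∈ G, 0 ≤ inner ℝ v g) :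
    {x | x ∈ PointedCone.hull ℝ G ∧ inner ℝ v x = 0} =
      (PointedCone.hull ℝ {g ∈ G | inner ℝ v g = 0} : Set V) := by
  have hexp := isExposed_inner_eq_zero hv
  rw [face_eq_hull_inter hexp.isExtreme ⟨0, zero_mem _, by simp⟩
    (hexp.convex (PointedCone.convex _))]
  congr 2
  ext g
  constructor
  · rintro ⟨h1, -, h2⟩; exact ⟨h1, h2⟩
  · rintro ⟨h1, h2⟩; exact ⟨h1, Submodule.subset_span h1, h2⟩

theorem isExposed_of_inner_eq_zero_iff {G E : Set V} {v : V}
    (hE : IsExtreme ℝ (PointedCone.hull ℝ G : Set V) E) (hne : E.Nonempty) (hc : Convex ℝ E)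
    (hv : ∀ g ∈ G, 0 ≤ inner ℝ v g) (h0 : ∀ g ∈ G, inner ℝ v g = 0 ↔ g ∈ E) :
    IsExposed ℝ (PointedCone.hull ℝ G : Set V) E := by
  have : E = {x | x ∈ PointedCone.hull ℝ G ∧ inner ℝ v x = 0} := by
    rw [zero_set_eq_hull hv, face_eq_hull_inter hE hne hc]
    congr 2
    ext g
    exact and_congr_right fun hg => (h0 g hg).symm
  rw [this]
  exact isExposed_inner_eq_zero hv

/-- A proper face of a convex cone lies on a supporting hyperplane that does not contain the
cone. -/
theorem exists_supporting_of_face_ne [FiniteDimensional ℝ V] {K : PointedCone ℝ V} {E : Set V}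
    (hE : IsExtreme ℝ (K : Set V) E) (hne : E.Nonempty) (hc : Convex ℝ E) (hEK : E ≠ K) :
    ∃ v : V, (∀ x ∈ K, 0 ≤ inner ℝ v x) ∧ (∀ x ∈ E, inner ℝ v x = 0) ∧
      ∃ x ∈ K, inner ℝ v x ≠ 0 := by
  -- Inside its span the cone has nonempty interior, and separating that interior from `E` gives a
  -- functional that is nonzero on the cone.
  let W := Submodule.span ℝ (K : Set V)
  let K' : Set W := W.subtype ⁻¹' K
  let E' : Set W := W.subtype ⁻¹' E
  have hK'c : Convex ℝ K' := K.convex.linear_preimage W.subtype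
  have hE'c : Convex ℝ E' := hc.linear_preimage W.subtype
  have hKW : ∀ x ∈ K, x ∈ W := fun x hx => Submodule.subset_span hx
  have hspan : Submodule.span ℝ K' = ⊤ := Submodule.span_span_coe_preimage
  have h0K' : (0 : W) ∈ K' := by simp [K']
  have hint : (interior K').Nonempty := by
    rw [hK'c.interior_nonempty_iff_affineSpan_eq_top]
    rw [← AffineSubspace.direction_eq_top_iff_of_nonempty ⟨0, subset_affineSpan ℝ _ h0K'⟩,
      direction_affineSpan, vectorSpan_eq_span_vsub_set_right ℝ h0K']
    simpa using hspan
  obtain ⟨c, hcK, hcE⟩ : ∃ c ∈ K, c ∉ E := by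
    by_contra! h
    exact hEK (hE.subset.antisymm h)
  have hdisj : Disjoint (interior K') E' := by
    rw [Set.disjoint_left]
    intro x hx hxE
    let c' : W := ⟨c, hKW c hcK⟩
    -- The segment from `c` can be continued slightly past `x` within the cone, so extremality would
    -- put `c` into `E`.
    have hcont : ContinuousAt (fun ε : ℝ => x + ε • (x - c')) 0 := by fun_prop
    have hev := hcont.eventually (p := fun y => y ∈ K') (by
      simpa using mem_interior_iff_mem_nhds.1 hx)
    obtain ⟨ε, hε, hεK⟩ : ∃ ε : ℝ, 0 < ε ∧ x + ε • (x - c') ∈ K' := by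
      obtain ⟨δ, hδ, h⟩ := Metric.eventually_nhds_iff.1 hev
      exact ⟨δ / 2, by positivity, h (by simp [abs_of_pos hδ, hδ])⟩
    refine hcE (hE.left_mem_of_mem_openSegment hcK hεK hxE
      ⟨ε / (1 + ε), 1 / (1 + ε), by positivity, by positivity, by field_simp; ring, ?_⟩)
    have h1 : (1 + ε) ≠ 0 := by positivity
    simp only [Submodule.subtype_apply, Submodule.coe_add, Submodule.coe_smul, Submodule.coe_sub,
      c']
    match_scalars
    · field_simp; ring
    · field_simp
  obtain ⟨f, u, hfu, huf⟩ :=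
    geometric_hahn_banach_open hK'c.interior isOpen_interior hE'c hdisj
  have hle : ∀ x ∈ K', f x ≤ u := by
    have hcl : K' ⊆ closure (interior K') := by
      rw [hK'c.closure_interior_eq_closure_of_nonempty_interior hint]
      exact subset_closure
    have : closure (interior K') ⊆ {x | f x ≤ u} :=
      closure_minimal (fun x hx => (hfu x hx).le) (isClosed_le f.continuous continuous_const)
    exact hcl.trans this
  have h0E : (0 : W) ∈ E' := by
    simpa [E'] using zero_mem_of_isExtreme hE hne
  -- The origin lies in both sets, so the separating level is 0.
  have hu : u = 0 := le_antisymm (by simpa using huf 0 h0E) (by simpa using hle 0 h0K')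
  subst hu
  let w : W := (InnerProductSpace.toDual ℝ W).symm f
  have hw : ∀ x : W, inner ℝ (w : V) (x : V) = f x := fun x => by
    rw [← Submodule.coe_inner]; exact InnerProductSpace.toDual_symm_apply
  refine ⟨-(w : V), fun x hx => ?_, fun x hx => ?_, ?_⟩
  · rw [inner_neg_left, hw ⟨x, hKW x hx⟩]
    linarith [hle ⟨x, hKW x hx⟩ hx]
  · have hxK := hE.subset hx
    rw [inner_neg_left, hw ⟨x, hKW x hxK⟩]
    linarith [hle ⟨x, hKW x hxK⟩ hxK, huf ⟨x, hKW x hxK⟩ hx]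
  · obtain ⟨x, hx⟩ := hint
    have hxK : x ∈ K' := interior_subset hx
    refine ⟨x, hxK, ?_⟩
    rw [inner_neg_left, hw x]
    exact neg_ne_zero.2 (hfu x hx).ne

end Faces

/-! ### The circular arc of angles between `0` and `π / 4` -/

/-- `(s, k) = (sin t, cos t)` for some `t ∈ [0, π / 4]`. -/
structure OnArc (s k : ℝ) : Prop where
  nonneg : 0 ≤ s
  le : s ≤ k
  sq : s ^ 2 + k ^ 2 = 1

/-- `√2 / 2`, the common value of sine and cosine at `π / 4`. -/
def r : ℝ := √2 / 2

theorem r_pos : 0 < r := by unfold r; positivity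

theorem r_sq : r ^ 2 = 1 / 2 := by
  unfold r; rw [div_pow, Real.sq_sqrt (by norm_num)]; norm_num

theorem r_lt_one : r < 1 := by nlinarith [r_pos, r_sq]

theorem half_lt_r : 1 / 2 < r := by nlinarith [r_pos, r_sq]

theorem onArc_sin_cos {t : ℝ} (ht : t ∈ Set.Icc 0 (Real.pi / 4)) :
    OnArc (Real.sin t) (Real.cos t) := by
  have hpi := Real.pi_pos
  refine ⟨Real.sin_nonneg_of_nonneg_of_le_pi ht.1 (by linarith [ht.2]), ?_,
    Real.sin_sq_add_cos_sq t⟩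
  rw [← Real.cos_pi_div_two_sub]
  exact Real.cos_le_cos_of_nonneg_of_le_pi ht.1 (by linarith [ht.1]) (by linarith [ht.2])

namespace OnArc

theorem r_r : OnArc r r := ⟨r_pos.le, le_rfl, by linarith [r_sq]⟩

theorem zero_one : OnArc 0 1 := ⟨le_rfl, zero_le_one, by norm_num⟩

variable {s k s' k' : ℝ}

theorem le_r (h : OnArc s k) : s ≤ r := by
  have := h.nonneg; have := h.le; have := h.sq; nlinarith [r_pos, r_sq]

theorem r_le (h : OnArc s k) : r ≤ k := by
  have := h.nonneg; have := h.le; have := h.sq; nlinarith [r_pos, r_sq]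

theorem pos (h : OnArc s k) : 0 < k := r_pos.trans_le h.r_le

theorem le_one (h : OnArc s k) : k ≤ 1 := by
  have := h.sq; nlinarith [sq_nonneg s, h.pos]

theorem one_le_add (h : OnArc s k) : 1 ≤ s + k := by
  have := h.sq; nlinarith [h.nonneg, h.pos, mul_nonneg h.nonneg h.pos.le]

theorem exists_angle (h : OnArc s k) :
    ∃ t ∈ Set.Icc 0 (Real.pi / 4), Real.sin t = s ∧ Real.cos t = k := by
  have hs : s ≤ 1 := h.le.trans h.le_one
  have h0 := h.nonneg
  refine ⟨Real.arcsin s, ⟨Real.arcsin_nonneg.2 h0, ?_⟩, Real.sin_arcsin (by linarith) hs, ?_⟩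
  · rw [Real.arcsin_le_iff_le_sin' ⟨by linarith [Real.pi_pos], by linarith [Real.pi_pos]⟩,
      Real.sin_pi_div_four]
    exact h.le_r
  · rw [Real.cos_arcsin, show 1 - s ^ 2 = k ^ 2 by linarith [h.sq], Real.sqrt_sq h.pos.le]

theorem right_unique (h : OnArc s k) (h' : OnArc s k') : k = k' := by
  have := h.sq; have := h'.sq; have := h.pos; have := h'.pos
  nlinarith

theorem eq_r (h : OnArc s k) (hr : r ≤ s) : s = r ∧ k = r := by
  have hs : s = r := le_antisymm h.le_r hr
  subst hs
  exact ⟨rfl, h.right_unique r_r⟩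

theorem eq_r_of_le (h : OnArc s k) (hr : k ≤ s) : s = r ∧ k = r :=
  h.eq_r (h.r_le.trans hr)

theorem eq_zero_one_of_left (h : OnArc s k) (hs : s ≤ 0) : s = 0 ∧ k = 1 := by
  have hs : s = 0 := le_antisymm hs h.nonneg
  subst hs
  exact ⟨rfl, h.right_unique zero_one⟩

theorem eq_zero_one_of_right (h : OnArc s k) (hk : 1 ≤ k) : s = 0 ∧ k = 1 := by
  refine h.eq_zero_one_of_left ?_
  have := h.sq; nlinarith

theorem one_sub_le_sq (h : OnArc s k) : 1 - k ≤ s ^ 2 := by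
  have := h.sq; nlinarith [h.pos, h.le_one]

theorem half_sq_le_one_sub (h : OnArc s k) : s ^ 2 / 2 ≤ 1 - k := by
  have := h.sq; nlinarith [sq_nonneg (1 - k)]

/-- In angles, tan (t / 2) = (1 - cos t) / sin t is largest at π / 4. -/
theorem mul_one_sub_le (h : OnArc s k) : r * (1 - k) ≤ s * (1 - r) := by
  have h1 : (1 - k) * (1 + k) = s ^ 2 := by linarith [h.sq]
  have h2 : (1 - r) * (1 + r) = r ^ 2 := by linarith [r_sq]
  have h3 := h.nonneg; have h4 := h.pos; have h5 := h.le_r; have h6 := h.r_le; have h7 := r_pos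
  have h8 : s * (r * (1 + k)) ≥ s * (s * (1 + r)) :=
    mul_le_mul_of_nonneg_left (by nlinarith) h3
  have h9 : r * (1 - k) * ((1 + k) * (1 + r)) ≤ s * (1 - r) * ((1 + k) * (1 + r)) := by
    calc r * (1 - k) * ((1 + k) * (1 + r)) = r * (1 + r) * s ^ 2 := by rw [← h1]; ring
      _ ≤ s * (1 + k) * r ^ 2 := by nlinarith
      _ = _ := by rw [← h2]; ring
  exact le_of_mul_le_mul_right h9 (by positivity)

/-- The expression is half the squared distance between two unit vectors. It is the value, along an
arc, of the tangent functional at a point of that arc. -/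
theorem cross_nonneg (h : OnArc s k) (h' : OnArc s' k') : 0 ≤ 1 - s * s' - k * k' := by
  nlinarith [h.sq, h'.sq, sq_nonneg (s - s'), sq_nonneg (k - k')]

theorem eq_of_cross (h : OnArc s k) (h' : OnArc s' k') (h0 : 1 - s * s' - k * k' = 0) :
    s = s' ∧ k = k' := by
  have h1 : (s - s') ^ 2 + (k - k') ^ 2 = 0 := by linarith [h.sq, h'.sq]
  constructor <;> nlinarith [sq_nonneg (s - s'), sq_nonneg (k - k')]

/-- A linear form bounded by a positive constant on the arc attains it at most once. -/
theorem eq_of_linear_max {α β M : ℝ} (hM : 0 < M)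
    (hle : ∀ s k, OnArc s k → α * s + β * k ≤ M) (h : OnArc s k) (h' : OnArc s' k')
    (e : α * s + β * k = M) (e' : α * s' + β * k' = M) : s = s' ∧ k = k' := by
  by_contra hne
  have hlt : 0 < 1 - s * s' - k * k' :=
    lt_of_le_of_ne (h.cross_nonneg h') fun h0 => hne (h.eq_of_cross h' h0.symm)
  have hN : 0 < (s + s') ^ 2 + (k + k') ^ 2 := by
    have := h.pos; have := h'.pos; positivity
  -- The sum of two distinct maximizers has norm `n < 2`, so after normalization the form would take
  -- the value `2 * M / n > M`.
  set n := √((s + s') ^ 2 + (k + k') ^ 2) with hn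
  have hnpos : 0 < n := Real.sqrt_pos.2 hN
  have hnsq : n ^ 2 = (s + s') ^ 2 + (k + k') ^ 2 := Real.sq_sqrt hN.le
  have hn2 : n < 2 := by
    have := h.sq; have := h'.sq; nlinarith
  have hmid : OnArc ((s + s') / n) ((k + k') / n) := by
    refine ⟨?_, ?_, ?_⟩
    · have := h.nonneg; have := h'.nonneg; positivity
    · exact div_le_div_of_nonneg_right (add_le_add h.le h'.le) hnpos.le
    · rw [div_pow, div_pow, ← add_div, ← hnsq, div_self (by positivity)]
  have := hle _ _ hmid
  have h2 : α * ((s + s') / n) + β * ((k + k') / n) = 2 * M / n := by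
    field_simp; linarith
  rw [h2, div_le_iff₀ hnpos] at this
  nlinarith

end OnArc

open OnArc

/-- Nonnegativity near the origin along an arc whose tangent there is a strict descent direction. -/
theorem pos_of_nonneg_on_arc {m a b : ℝ} (hb : 0 < b)
    (h : ∀ s k, OnArc s k → 0 ≤ m + a * (1 - k) - b * s) : 0 < m := by
  have hm : 0 ≤ m := by have := h 0 1 zero_one; linarith
  rcases hm.eq_or_lt with rfl | hm
  swap
  · exact hm
  exfalso
  -- Small enough for `b * s` to dominate the error `|a| * s ^ 2`; the bound 1/2 keeps the point on
  -- the arc.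
  let s := min (1 / 2) (b / (2 * (|a| + 1)))
  have ha := abs_nonneg a
  have hs : 0 < s := by positivity
  have hs2 : s ≤ 1 / 2 := min_le_left _ _
  have hs3 : s ≤ b / (2 * (|a| + 1)) := min_le_right _ _
  rw [le_div_iff₀ (by positivity)] at hs3
  have hN : 0 ≤ 1 - s ^ 2 := by nlinarith
  have hk : OnArc s √(1 - s ^ 2) := by
    refine ⟨hs.le, Real.le_sqrt_of_sq_le (by nlinarith), ?_⟩
    rw [Real.sq_sqrt hN]; ring
  have h1 := h _ _ hk
  have h2 := hk.one_sub_le_sq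
  have h3 := hk.le_one
  have h4 : a * (1 - √(1 - s ^ 2)) ≤ |a| * s ^ 2 :=
    (mul_le_mul_of_nonneg_right (le_abs_self a) (by linarith)).trans
      (mul_le_mul_of_nonneg_left h2 ha)
  nlinarith

/-! ### Functionals on the plane of the third and fourth arcs -/

section Planar

variable {m a b : ℝ}

/-- The functional `m - ⟨(a, b), ·⟩` with `b > 0`, nonnegative on the planar arcs
`(-sin t, 1 - cos t)` and `(cos t - 1, sin t)`: its zeros. -/
structure PlanarZeros (m a b : ℝ) : Prop where
  pos : 0 < m
  third : ∀ s k, OnArc s k → m + a * s - b * (1 - k) = 0 → s = r ∧ k = r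
  fourth : ∀ s k s' k', OnArc s k → OnArc s' k' → m + a * (1 - k) - b * s = 0 →
    m + a * (1 - k') - b * s' = 0 → s = s' ∧ k = k'
  both : m + a * r - b * (1 - r) = 0 → ∀ s k, OnArc s k → m + a * (1 - k) - b * s = 0 →
    s = r ∧ k = r

/-- A zero of the third arc before its end would make the value at the end negative, by
`mul_one_sub_le`. On the fourth arc, uniqueness comes from `eq_of_linear_max` if `a ≥ 0` and from
strict monotonicity in `s` if `a < 0`. A zero at the third end and nonnegativity at the fourth end
force `a + b ≤ 0`, and then a zero of the fourth arc needs `k ≤ s`. -/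
theorem planarZeros_of_pos (hb : 0 < b)
    (h3 : ∀ s k, OnArc s k → 0 ≤ m + a * s - b * (1 - k))
    (h4 : ∀ s k, OnArc s k → 0 ≤ m + a * (1 - k) - b * s) : PlanarZeros m a b := by
  have hm := pos_of_nonneg_on_arc hb h4
  have hr0 := r_pos; have hr1 := r_lt_one; have hr2 := half_lt_r; have hrr := r_sq
  refine ⟨hm, fun s k h e => ?_, fun s k s' k' h h' e e' => ?_, fun e s k h e' => ?_⟩
  · refine h.eq_r (le_of_not_gt fun hlt => ?_)
    have h1 := h3 r r r_r
    have h2 := mul_le_mul_of_nonneg_left h.mul_one_sub_le hb.le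
    nlinarith [mul_nonneg h.nonneg h1, mul_pos hm (sub_pos.2 hlt)]
  · rcases le_or_gt 0 a with ha | ha
    · refine OnArc.eq_of_linear_max (α := b) (β := a) (M := m + a) (by linarith)
        (fun s k h => by linarith [h4 s k h]) h h' (by linarith) (by linarith)
    · have key : ∀ {s k s' k' : ℝ}, OnArc s k → OnArc s' k' → m + a * (1 - k) - b * s = 0 →
          m + a * (1 - k') - b * s' = 0 → s ≤ s' := by
        intro s k s' k' h h' e e'
        by_contra! hlt
        have hk : k ≤ k' := by
          have := h.sq; have := h'.sq
          nlinarith [h.pos, h'.pos, h'.nonneg]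
        nlinarith
      have hs := le_antisymm (key h h' e e') (key h' h e' e)
      subst hs
      exact ⟨rfl, h.right_unique h'⟩
  · refine h.eq_r_of_le ?_
    have h1 := h4 r r r_r
    have hab : a + b ≤ 0 := by nlinarith
    have hk := h.r_le
    nlinarith

/-- The reflection (x, y) ↦ (-y, -x) exchanges the two arcs and turns `(a, b)` into `(-b, -a)`, so
the case of negative `a` and `b` reduces to `b > 0`. For `a ≥ 0 ≥ b` only the origin can be a zero;
for `a < 0 = b` only the third end can. -/
theorem planar_cases (hne : m ≠ 0 ∨ a ≠ 0 ∨ b ≠ 0)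
    (h3 : ∀ s k, OnArc s k → 0 ≤ m + a * s - b * (1 - k))
    (h4 : ∀ s k, OnArc s k → 0 ≤ m + a * (1 - k) - b * s) :
    PlanarZeros m a b ∨ PlanarZeros m (-b) (-a) ∨
    ((∀ s k, OnArc s k → m + a * s - b * (1 - k) = 0 → s = 0 ∧ k = 1) ∧
      ∀ s k, OnArc s k → m + a * (1 - k) - b * s = 0 → s = 0 ∧ k = 1) ∨
    (0 < m ∧ b = 0 ∧ (∀ s k, OnArc s k → m + a * s - b * (1 - k) = 0 → s = r ∧ k = r) ∧
      ∀ s k, OnArc s k → m + a * (1 - k) - b * s ≠ 0) := by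
  have hm : 0 ≤ m := by have := h3 0 1 zero_one; linarith
  rcases lt_or_ge 0 b with hb | hb
  · exact Or.inl (planarZeros_of_pos hb h3 h4)
  rcases lt_or_ge a 0 with ha | ha
  · rcases hb.eq_or_lt with rfl | hb
    · right; right; right
      have hmr := h3 r r r_r
      have hr0 := r_pos; have hr2 := half_lt_r
      refine ⟨by nlinarith, rfl, fun s k h e => h.eq_r ?_, fun s k h e => ?_⟩
      · nlinarith
      · nlinarith [h.r_le]
    · right; left
      refine planarZeros_of_pos (by linarith) (fun s k h => ?_) fun s k h => ?_
      · linarith [h4 s k h]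
      · linarith [h3 s k h]
  · rcases hm.eq_or_lt with rfl | hm
    · right; right; left
      have hpos : 0 < a ∨ b < 0 := by
        rcases ha.eq_or_lt with rfl | ha
        · right; exact lt_of_le_of_ne hb (by simpa using hne)
        · exact Or.inl ha
      constructor <;> intro s k h e <;> rcases hpos with hp | hp
      · exact h.eq_zero_one_of_left (by nlinarith [h.le_one])
      · exact h.eq_zero_one_of_right (by nlinarith [h.nonneg])
      · exact h.eq_zero_one_of_right (by nlinarith [h.nonneg])
      · exact h.eq_zero_one_of_left (by nlinarith [h.le_one])
    · right; right; left
      constructor <;> intro s k h e <;>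
        nlinarith [h.le_one, h.nonneg, mul_nonneg ha h.nonneg, mul_nonneg (neg_nonneg.2 hb) h.nonneg,
          mul_nonneg ha (sub_nonneg.2 h.le_one), mul_nonneg (neg_nonneg.2 hb) (sub_nonneg.2 h.le_one)]

end Planar

/-! ### Functionals on the first and second arcs -/

section Spatial

variable {m a b c : ℝ}

/-- For `b > 0` the first arc carries no zeros, the second at most one. -/
theorem spatialZeros_of_pos (hm : 0 < m) (hb : 0 < b)
    (h2 : ∀ s k, OnArc s k → 0 ≤ m + b * (1 - k) + c * s) :
    (∀ s k, OnArc s k → m + b * s + c * (1 - k) ≠ 0) ∧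
    (∀ s k s' k', OnArc s k → OnArc s' k' → m + b * (1 - k) + c * s = 0 →
      m + b * (1 - k') + c * s' = 0 → s = s' ∧ k = k') := by
  have hr0 := r_pos; have hr1 := r_lt_one; have hr2 := half_lt_r
  refine ⟨fun s k h e => ?_, fun s k s' k' h h' e e' => ?_⟩
  · have h1 := h2 r r r_r
    have hk := h.r_le
    have hk1 := h.le_one
    -- Eliminating `c` between the supposed zero and the inequality at the second end makes the sum
    -- of the quantities in `hp` and `hq` nonpositive.
    have hp : 0 < m * (r - 1 + k) := mul_pos hm (by linarith)
    have hq : 0 ≤ b * (r * s - (1 - r) * (1 - k)) := by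
      refine mul_nonneg hb.le ?_
      nlinarith [h.one_le_add, h.nonneg]
    nlinarith [mul_nonneg h1 (sub_nonneg.2 hk1)]
  · exact OnArc.eq_of_linear_max (α := -c) (β := b) (M := m + b) (by linarith)
      (fun s k h => by linarith [h2 s k h]) h h' (by linarith) (by linarith)

/-- The two end conditions force `a = -b` and `m = b`. A zero on the second arc then has `s / (2 -
k) ≥ r / (2 - r)`, but `s + k ≤ 2 * r` makes this quotient largest only at the end of the arc. -/
theorem second_zero_of_third_fourth (hb : 0 < b)
    (h2 : ∀ s k, OnArc s k → 0 ≤ m + b * (1 - k) + c * s)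
    (e3 : m + a * r - b * (1 - r) = 0) (e4 : m + a * (1 - r) - b * r = 0)
    {s k : ℝ} (h : OnArc s k) (e : m + b * (1 - k) + c * s = 0) : s = r ∧ k = r := by
  have hr0 := r_pos; have hr1 := r_lt_one; have hr2 := half_lt_r
  have ha : a = -b := by
    have : (a + b) * (2 * r - 1) = 0 := by linarith
    rcases mul_eq_zero.1 this with h | h <;> linarith
  have hmb : m = b := by subst ha; linarith
  subst ha hmb
  have h1 := h2 r r r_r
  have h4 : (2 - k) * r ≤ (2 - r) * s := by
    have : m * ((2 - k) * r) ≤ m * ((2 - r) * s) := by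
      nlinarith [mul_nonneg h1 h.nonneg]
    exact le_of_mul_le_mul_left this hb
  refine h.eq_r (le_of_not_gt fun hlt => ?_)
  have hk := h.r_le
  have hsum : (k - r) * (k + r) = (r - s) * (r + s) := by linarith [h.sq, r_sq]
  have hkr : k - r ≤ r - s := by
    by_contra! hc
    nlinarith
  nlinarith

end Spatial

/-! ### The four arcs in coordinates -/

/-- The point of the first arc with sine `s` and cosine `k`. -/
def pt₁ (s k : ℝ) : Eucl 3 := !₂[0, -s, k - 1]

/-- The point of the second arc with sine `s` and cosine `k`. -/
def pt₂ (s k : ℝ) : Eucl 3 := !₂[0, k - 1, -s]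

/-- The point of the third arc with sine `s` and cosine `k`. -/
def pt₃ (s k : ℝ) : Eucl 3 := !₂[-s, 1 - k, 0]

/-- The point of the fourth arc with sine `s` and cosine `k`. -/
def pt₄ (s k : ℝ) : Eucl 3 := !₂[k - 1, s, 0]

theorem mem_arc_iff {γ : ℝ → Eucl 3} {p : ℝ → ℝ → Eucl 3}
    (h : ∀ t, γ t = p (Real.sin t) (Real.cos t)) {x : Eucl 3} :
    x ∈ arc γ ↔ ∃ s k, OnArc s k ∧ x = p s k := by
  constructor
  · rintro ⟨t, ht, rfl⟩
    exact ⟨_, _, onArc_sin_cos ht, h t⟩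
  · rintro ⟨s, k, hsk, rfl⟩
    obtain ⟨t, ht, rfl, rfl⟩ := hsk.exists_angle
    exact ⟨t, ht, h t⟩

theorem mem_arc₁ {x : Eucl 3} : x ∈ arc γ₁ ↔ ∃ s k, OnArc s k ∧ x = pt₁ s k :=
  mem_arc_iff (p := pt₁) fun _ => rfl

theorem mem_arc₂ {x : Eucl 3} : x ∈ arc γ₂ ↔ ∃ s k, OnArc s k ∧ x = pt₂ s k :=
  mem_arc_iff (p := pt₂) fun _ => rfl

theorem mem_arc₃ {x : Eucl 3} : x ∈ arc γ₃ ↔ ∃ s k, OnArc s k ∧ x = pt₃ s k :=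
  mem_arc_iff (p := pt₃) fun _ => rfl

theorem mem_arc₄ {x : Eucl 3} : x ∈ arc γ₄ ↔ ∃ s k, OnArc s k ∧ x = pt₄ s k :=
  mem_arc_iff (p := pt₄) fun _ => rfl

/-- The union of the four arcs. -/
def arcs : Set (Eucl 3) := arc γ₁ ∪ arc γ₂ ∪ arc γ₃ ∪ arc γ₄

theorem mem_arcs {x : Eucl 3} : x ∈ arcs ↔
    ∃ s k, OnArc s k ∧ (x = pt₁ s k ∨ x = pt₂ s k ∨ x = pt₃ s k ∨ x = pt₄ s k) := by
  simp only [arcs, Set.mem_union, mem_arc₁, mem_arc₂, mem_arc₃, mem_arc₄]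
  constructor
  · rintro (((⟨s, k, h, e⟩ | ⟨s, k, h, e⟩) | ⟨s, k, h, e⟩) | ⟨s, k, h, e⟩) <;>
      exact ⟨s, k, h, by simp [e]⟩
  · rintro ⟨s, k, h, e | e | e | e⟩
    · exact Or.inl (Or.inl (Or.inl ⟨s, k, h, e⟩))
    · exact Or.inl (Or.inl (Or.inr ⟨s, k, h, e⟩))
    · exact Or.inl (Or.inr ⟨s, k, h, e⟩)
    · exact Or.inr ⟨s, k, h, e⟩

theorem pt₁_mem {s k : ℝ} (h : OnArc s k) : pt₁ s k ∈ arcs := mem_arcs.2 ⟨s, k, h, by simp⟩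
theorem pt₂_mem {s k : ℝ} (h : OnArc s k) : pt₂ s k ∈ arcs := mem_arcs.2 ⟨s, k, h, by simp⟩
theorem pt₃_mem {s k : ℝ} (h : OnArc s k) : pt₃ s k ∈ arcs := mem_arcs.2 ⟨s, k, h, by simp⟩
theorem pt₄_mem {s k : ℝ} (h : OnArc s k) : pt₄ s k ∈ arcs := mem_arcs.2 ⟨s, k, h, by simp⟩

theorem pt₁_zero_one : pt₁ 0 1 = 0 := by ext i; fin_cases i <;> simp [pt₁]
theorem pt₂_zero_one : pt₂ 0 1 = 0 := by ext i; fin_cases i <;> simp [pt₂]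
theorem pt₃_zero_one : pt₃ 0 1 = 0 := by ext i; fin_cases i <;> simp [pt₃]
theorem pt₄_zero_one : pt₄ 0 1 = 0 := by ext i; fin_cases i <;> simp [pt₄]

/-- The affine functional `m - ⟨(a, b, c), ·⟩`. -/
def val (m a b c : ℝ) (x : Eucl 3) : ℝ := m - (a * x 0 + b * x 1 + c * x 2)

section

variable (m a b c s k : ℝ)

theorem val_pt₁ : val m a b c (pt₁ s k) = m + b * s + c * (1 - k) := by
  simp [val, pt₁]; ring

theorem val_pt₂ : val m a b c (pt₂ s k) = m + b * (1 - k) + c * s := by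
  simp [val, pt₂]; ring

theorem val_pt₃ : val m a b c (pt₃ s k) = m + a * s - b * (1 - k) := by
  simp [val, pt₃]; ring

theorem val_pt₄ : val m a b c (pt₄ s k) = m + a * (1 - k) - b * s := by
  simp [val, pt₄]; ring

end

/-- The involution `(x, y, z) ↦ (z, -y, x)`, which exchanges the first arc with the fourth and the
second with the third. -/
def swap (x : Eucl 3) : Eucl 3 := !₂[x 2, -x 1, x 0]

theorem swap_swap (x : Eucl 3) : swap (swap x) = x := by
  ext i; fin_cases i <;> simp [swap]

theorem swap_pt₁ (s k : ℝ) : swap (pt₁ s k) = pt₄ s k := by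
  ext i; fin_cases i <;> simp [swap, pt₁, pt₄]

theorem swap_pt₂ (s k : ℝ) : swap (pt₂ s k) = pt₃ s k := by
  ext i; fin_cases i <;> simp [swap, pt₂, pt₃]

theorem swap_pt₃ (s k : ℝ) : swap (pt₃ s k) = pt₂ s k := by
  rw [← swap_pt₂, swap_swap]

theorem swap_pt₄ (s k : ℝ) : swap (pt₄ s k) = pt₁ s k := by
  rw [← swap_pt₁, swap_swap]

theorem swap_mem_arcs {x : Eucl 3} (hx : x ∈ arcs) : swap x ∈ arcs := by
  obtain ⟨s, k, h, rfl | rfl | rfl | rfl⟩ := mem_arcs.1 hx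
  · rw [swap_pt₁]; exact pt₄_mem h
  · rw [swap_pt₂]; exact pt₃_mem h
  · rw [swap_pt₃]; exact pt₂_mem h
  · rw [swap_pt₄]; exact pt₁_mem h

theorem swap_eq_iff {x y : Eucl 3} : swap x = y ↔ x = swap y :=
  ⟨fun h => by rw [← h, swap_swap], fun h => by rw [h, swap_swap]⟩

theorem val_swap (m a b c : ℝ) (x : Eucl 3) : val m a b c (swap x) = val m c (-b) a x := by
  simp [val, swap]; ring

/-! ### Sets of arc points cut out by a supporting functional -/

/-- `S` is the set of zeros on the arcs of an affine functional nonnegative on the arcs. -/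
def IsZeroSet (S : Set (Eucl 3)) : Prop :=
  ∃ m a b c : ℝ, ∀ x ∈ arcs, 0 ≤ val m a b c x ∧ (val m a b c x = 0 ↔ x ∈ S)

theorem IsZeroSet.swap {S : Set (Eucl 3)} (h : IsZeroSet S) : IsZeroSet (swap ⁻¹' S) := by
  obtain ⟨m, a, b, c, h⟩ := h
  refine ⟨m, c, -b, a, fun x hx => ?_⟩
  rw [← val_swap]
  exact h _ (swap_mem_arcs hx)

theorem isZeroSet_of {S : Set (Eucl 3)} (m a b c : ℝ)
    (h₁ : ∀ s k, OnArc s k → 0 ≤ m + b * s + c * (1 - k) ∧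
      (m + b * s + c * (1 - k) = 0 → pt₁ s k ∈ S))
    (h₂ : ∀ s k, OnArc s k → 0 ≤ m + b * (1 - k) + c * s ∧
      (m + b * (1 - k) + c * s = 0 → pt₂ s k ∈ S))
    (h₃ : ∀ s k, OnArc s k → 0 ≤ m + a * s - b * (1 - k) ∧
      (m + a * s - b * (1 - k) = 0 → pt₃ s k ∈ S))
    (h₄ : ∀ s k, OnArc s k → 0 ≤ m + a * (1 - k) - b * s ∧
      (m + a * (1 - k) - b * s = 0 → pt₄ s k ∈ S))
    (hS : ∀ x ∈ S, val m a b c x = 0) : IsZeroSet S := by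
  refine ⟨m, a, b, c, fun x hx => ?_⟩
  obtain ⟨s, k, h, e⟩ := mem_arcs.1 hx
  have hnn : 0 ≤ val m a b c x ∧ (val m a b c x = 0 → x ∈ S) := by
    rcases e with rfl | rfl | rfl | rfl
    · rw [val_pt₁]; exact h₁ s k h
    · rw [val_pt₂]; exact h₂ s k h
    · rw [val_pt₃]; exact h₃ s k h
    · rw [val_pt₄]; exact h₄ s k h
  exact ⟨hnn.1, hnn.2, hS x⟩

theorem nonneg_and_of_pos {t : ℝ} {p : Prop} (h : 0 < t) : 0 ≤ t ∧ (t = 0 → p) :=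
  ⟨h.le, fun h0 => absurd h0 h.ne'⟩

theorem isZeroSet_empty : IsZeroSet ∅ :=
  ⟨1, 0, 0, 0, fun x _ => by simp [val]⟩

theorem isZeroSet_zero : IsZeroSet {0} := by
  refine isZeroSet_of 0 1 0 1 ?_ ?_ ?_ ?_ (by rintro x rfl; simp [val]) <;> intro s k h
  · refine ⟨by linarith [h.le_one], fun e => ?_⟩
    obtain ⟨rfl, rfl⟩ := h.eq_zero_one_of_right (by linarith)
    exact pt₁_zero_one
  · refine ⟨by linarith [h.nonneg], fun e => ?_⟩
    obtain ⟨rfl, rfl⟩ := h.eq_zero_one_of_left (by linarith)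
    exact pt₂_zero_one
  · refine ⟨by linarith [h.nonneg], fun e => ?_⟩
    obtain ⟨rfl, rfl⟩ := h.eq_zero_one_of_left (by linarith)
    exact pt₃_zero_one
  · refine ⟨by linarith [h.le_one], fun e => ?_⟩
    obtain ⟨rfl, rfl⟩ := h.eq_zero_one_of_right (by linarith)
    exact pt₄_zero_one

theorem isZeroSet_arc₃_union_arc₄ : IsZeroSet (arc γ₃ ∪ arc γ₄) := by
  refine isZeroSet_of 0 0 0 1 ?_ ?_ ?_ ?_ ?_
  · intro s k h
    refine ⟨by linarith [h.le_one], fun e => ?_⟩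
    obtain ⟨rfl, rfl⟩ := h.eq_zero_one_of_right (by linarith)
    rw [pt₁_zero_one, ← pt₃_zero_one]
    exact Or.inl (mem_arc₃.2 ⟨0, 1, h, rfl⟩)
  · intro s k h
    refine ⟨by linarith [h.nonneg], fun e => ?_⟩
    obtain ⟨rfl, rfl⟩ := h.eq_zero_one_of_left (by linarith)
    rw [pt₂_zero_one, ← pt₃_zero_one]
    exact Or.inl (mem_arc₃.2 ⟨0, 1, h, rfl⟩)
  · exact fun s k h => ⟨by simp, fun _ => Or.inl (mem_arc₃.2 ⟨s, k, h, rfl⟩)⟩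
  · exact fun s k h => ⟨by simp, fun _ => Or.inr (mem_arc₄.2 ⟨s, k, h, rfl⟩)⟩
  · rintro x (hx | hx)
    · obtain ⟨s, k, -, rfl⟩ := mem_arc₃.1 hx
      rw [val_pt₃]; ring
    · obtain ⟨s, k, -, rfl⟩ := mem_arc₄.1 hx
      rw [val_pt₄]; ring

theorem swap_preimage_arcs :
    swap ⁻¹' (arc γ₃ ∪ arc γ₄) = arc γ₁ ∪ arc γ₂ := by
  ext x
  simp only [Set.mem_preimage, Set.mem_union, mem_arc₁, mem_arc₂, mem_arc₃, mem_arc₄,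
    swap_eq_iff, swap_pt₃, swap_pt₄]
  exact or_comm

theorem isZeroSet_arc₁_union_arc₂ : IsZeroSet (arc γ₁ ∪ arc γ₂) :=
  swap_preimage_arcs ▸ isZeroSet_arc₃_union_arc₄.swap

theorem isZeroSet_pt₄ {s k : ℝ} (h : OnArc s k) : IsZeroSet {pt₄ s k} := by
  rcases h.nonneg.eq_or_lt with h0 | h0
  · obtain ⟨rfl, rfl⟩ := h.eq_zero_one_of_left h0.ge
    rw [pt₄_zero_one]; exact isZeroSet_zero
  have hk := h.pos
  have hm : 0 < 1 - k := by nlinarith [h.half_sq_le_one_sub, pow_pos h0 2]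
  -- The tangent line of the fourth circle at the point, with no tilt in the third coordinate.
  refine isZeroSet_of (1 - k) k s 0 ?_ ?_ ?_ ?_ ?_
  · exact fun s' k' h' => nonneg_and_of_pos (by
      have := mul_nonneg h0.le h'.nonneg; linarith)
  · intro s' k' h'
    have := mul_nonneg h0.le (sub_nonneg.2 h'.le_one)
    exact nonneg_and_of_pos (by linarith)
  · intro s' k' h'
    have h1 : s * (1 - k') ≤ k * s' :=
      mul_le_mul h.le (by linarith [h'.one_le_add]) (by linarith [h'.le_one]) hk.le
    exact nonneg_and_of_pos (by linarith)
  · intro s' k' h'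
    have e : 1 - k + k * (1 - k') - s * s' = 1 - s * s' - k * k' := by ring
    rw [e]
    refine ⟨h.cross_nonneg h', fun e => ?_⟩
    obtain ⟨rfl, rfl⟩ := h.eq_of_cross h' e
    rfl
  · rintro x rfl
    rw [val_pt₄]; linarith [h.sq]

theorem isZeroSet_pt₃ {s k : ℝ} (h : OnArc s k) : IsZeroSet {pt₃ s k} := by
  rcases h.nonneg.eq_or_lt with h0 | h0
  · obtain ⟨rfl, rfl⟩ := h.eq_zero_one_of_left h0.ge
    rw [pt₃_zero_one]; exact isZeroSet_zero
  have hk := h.pos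
  have hk1 := h.le_one
  have hm : 0 < 1 - k := by nlinarith [h.half_sq_le_one_sub, pow_pos h0 2]
  set m := 1 - k with hmdef
  -- The tangent functional of the third circle goes negative on the first arc; the tilt `m⁻¹` in
  -- the third coordinate repairs this by completing a square. The tilt blows up as the point tends
  -- to the origin, the same tangency that destroys niceness.
  refine isZeroSet_of m (-s) (-k) m⁻¹ ?_ ?_ ?_ ?_ ?_
  · intro s' k' h'
    have h1 : m⁻¹ * (s' ^ 2 / 2) ≤ m⁻¹ * (1 - k') :=
      mul_le_mul_of_nonneg_left h'.half_sq_le_one_sub (inv_pos.2 hm).le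
    have h2 : k * s' ≤ s' := mul_le_of_le_one_left h'.nonneg hk1
    have h3 : m - s' + m⁻¹ * (s' ^ 2 / 2) = ((m - s') ^ 2 + m ^ 2) / (2 * m) := by
      field_simp; ring
    have h4 : 0 < ((m - s') ^ 2 + m ^ 2) / (2 * m) := by positivity
    exact nonneg_and_of_pos (by linarith)
  · intro s' k' h'
    have h1 : s' ≤ m⁻¹ * s' :=
      le_mul_of_one_le_left h'.nonneg (one_le_inv_iff₀.2 ⟨hm, by linarith⟩)
    have h2 : k * (1 - k') ≤ 1 - k' := mul_le_of_le_one_left (by linarith [h'.le_one]) hk1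
    exact nonneg_and_of_pos (by linarith [h'.one_le_add])
  · intro s' k' h'
    have e : m + -s * s' - -k * (1 - k') = 1 - s * s' - k * k' := by rw [hmdef]; ring
    rw [e]
    refine ⟨h.cross_nonneg h', fun e => ?_⟩
    obtain ⟨rfl, rfl⟩ := h.eq_of_cross h' e
    rfl
  · intro s' k' h'
    have h1 : s * (1 - k') ≤ k * s' :=
      mul_le_mul h.le (by linarith [h'.one_le_add]) (by linarith [h'.le_one]) hk.le
    exact nonneg_and_of_pos (by linarith)
  · rintro x rfl
    rw [val_pt₃]; linarith [h.sq]

theorem isZeroSet_singleton {x : Eucl 3} (hx : x ∈ arcs) : IsZeroSet {x} := by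
  have hpre : ∀ y : Eucl 3, swap ⁻¹' {swap y} = {y} := fun y => by
    ext z; simp [swap_eq_iff, swap_swap]
  obtain ⟨s, k, h, rfl | rfl | rfl | rfl⟩ := mem_arcs.1 hx
  · rw [← hpre, swap_pt₁]; exact (isZeroSet_pt₄ h).swap
  · rw [← hpre, swap_pt₂]; exact (isZeroSet_pt₃ h).swap
  · exact isZeroSet_pt₃ h
  · exact isZeroSet_pt₄ h

theorem swap_preimage_pair (x y : Eucl 3) : swap ⁻¹' {x, y} = {swap x, swap y} := by
  ext z; simp [swap_eq_iff]

theorem isZeroSet_ends₃₄ : IsZeroSet {pt₃ r r, pt₄ r r} := by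
  have hr := r_lt_one
  have h0 := r_pos
  refine isZeroSet_of 1 (-1) 1 0 ?_ ?_ ?_ ?_ ?_
  · exact fun s k h => nonneg_and_of_pos (by linarith [h.nonneg])
  · exact fun s k h => nonneg_and_of_pos (by linarith [h.le_one])
  · intro s k h
    refine ⟨by linarith [h.le], fun e => ?_⟩
    obtain ⟨rfl, rfl⟩ := h.eq_r_of_le (by linarith)
    simp
  · intro s k h
    refine ⟨by linarith [h.le], fun e => ?_⟩
    obtain ⟨rfl, rfl⟩ := h.eq_r_of_le (by linarith)
    simp
  · rintro x (rfl | rfl)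
    · rw [val_pt₃]; ring
    · rw [val_pt₄]; ring

theorem isZeroSet_ends₂₃ : IsZeroSet {pt₂ r r, pt₃ r r} := by
  have hr := half_lt_r
  refine isZeroSet_of r (-1) 0 (-1) ?_ ?_ ?_ ?_ ?_
  · exact fun s k h => nonneg_and_of_pos (by linarith [h.r_le])
  · intro s k h
    refine ⟨by linarith [h.le_r], fun e => ?_⟩
    obtain ⟨rfl, rfl⟩ := h.eq_r (by linarith)
    simp
  · intro s k h
    refine ⟨by linarith [h.le_r], fun e => ?_⟩
    obtain ⟨rfl, rfl⟩ := h.eq_r (by linarith)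
    simp
  · exact fun s k h => nonneg_and_of_pos (by linarith [h.r_le])
  · rintro x (rfl | rfl)
    · rw [val_pt₂]; ring
    · rw [val_pt₃]; ring

theorem isZeroSet_ends₂₄ : IsZeroSet {pt₂ r r, pt₄ r r} := by
  have hr := half_lt_r
  have hr0 := r_pos
  have hr1 := r_lt_one
  have hrr := r_sq
  -- On the fourth arc the value is `r - s`; the coefficient `-(2 * r)` makes the functional vanish
  -- at the second end, because `2 * r ^ 2 = 1`.
  refine isZeroSet_of r 0 1 (-(2 * r)) ?_ ?_ ?_ ?_ ?_
  · intro s k h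
    have : 2 * r * (1 - k) ≤ 2 * r * (1 - r) :=
      mul_le_mul_of_nonneg_left (by linarith [h.r_le]) (by linarith)
    exact nonneg_and_of_pos (by nlinarith [h.nonneg])
  · intro s k h
    have hs := h.le_r
    have hk := h.r_le
    have hsum : (k - r) * (k + r) = (r - s) * (r + s) := by linarith [h.sq]
    have hkr : k - r ≤ r - s := by
      by_contra! hc
      nlinarith
    refine ⟨by nlinarith, fun e => ?_⟩
    obtain ⟨rfl, rfl⟩ := h.eq_r (by nlinarith)
    simp
  · exact fun s k h => nonneg_and_of_pos (by linarith [h.r_le])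
  · intro s k h
    refine ⟨by linarith [h.le_r], fun e => ?_⟩
    obtain ⟨rfl, rfl⟩ := h.eq_r (by linarith)
    simp
  · rintro x (rfl | rfl)
    · rw [val_pt₂]; nlinarith
    · rw [val_pt₄]; ring

theorem isZeroSet_ends₂₁ : IsZeroSet {pt₂ r r, pt₁ r r} := by
  have := isZeroSet_ends₃₄.swap
  rwa [swap_preimage_pair, swap_pt₃, swap_pt₄] at this

theorem isZeroSet_ends₃₁ : IsZeroSet {pt₃ r r, pt₁ r r} := by
  have := isZeroSet_ends₂₄.swap
  rwa [swap_preimage_pair, swap_pt₂, swap_pt₄] at this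

theorem isZeroSet_of_subset_singleton {S : Set (Eucl 3)} (hS : S ⊆ arcs) {x : Eucl 3}
    (h : S ⊆ {x}) : IsZeroSet S := by
  rcases Set.subset_singleton_iff_eq.1 h with rfl | rfl
  · exact isZeroSet_empty
  · exact isZeroSet_singleton (hS rfl)

theorem isZeroSet_of_subset_pair {S : Set (Eucl 3)} (hS : S ⊆ arcs) {x y : Eucl 3}
    (h : S ⊆ {x, y}) (hxy : x ∈ S → y ∈ S → IsZeroSet {x, y}) : IsZeroSet S := by
  by_cases hx : x ∈ S
  · by_cases hy : y ∈ S
    · have : S = {x, y} := h.antisymm (by rintro z (rfl | rfl) <;> assumption)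
      rw [this]; exact hxy hx hy
    · refine isZeroSet_of_subset_singleton hS (x := x) fun z hz => ?_
      rcases h hz with rfl | rfl
      · rfl
      · exact absurd hz hy
  · refine isZeroSet_of_subset_singleton hS (x := y) fun z hz => ?_
    rcases h hz with rfl | rfl
    · exact absurd hz hx
    · rfl

/-- If all three points occur, then `S = Z` is already cut out; smaller subsets use the pairs and
the single points. -/
theorem isZeroSet_of_subset_triple {S Z : Set (Eucl 3)} (hS : S ⊆ arcs) (hSZ : S ⊆ Z)
    (hZ : IsZeroSet Z) {x y z : Eucl 3} (h : Z ⊆ {x, y, z}) (hxy : IsZeroSet {x, y})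
    (hxz : IsZeroSet {x, z}) (hyz : IsZeroSet {y, z}) : IsZeroSet S := by
  by_cases hx : x ∈ S
  · by_cases hy : y ∈ S
    · by_cases hz : z ∈ S
      · have : S = Z := hSZ.antisymm (h.trans (by rintro w (rfl | rfl | rfl) <;> assumption))
        rwa [this]
      · refine isZeroSet_of_subset_pair hS (x := x) (y := y) (fun w hw => ?_) fun _ _ => hxy
        rcases h (hSZ hw) with rfl | rfl | rfl
        · simp
        · simp
        · exact absurd hw hz
    · refine isZeroSet_of_subset_pair hS (x := x) (y := z) (fun w hw => ?_) fun _ _ => hxz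
      rcases h (hSZ hw) with rfl | rfl | rfl
      · simp
      · exact absurd hw hy
      · simp
  · refine isZeroSet_of_subset_pair hS (x := y) (y := z) (fun w hw => ?_) fun _ _ => hyz
    rcases h (hSZ hw) with rfl | rfl | rfl
    · exact absurd hw hx
    · simp
    · simp

/-! ### Classification of the zero sets -/

section

variable {m a b c : ℝ}

/-- The curves are abstract so that one argument serves both planes, with `(p, q)` the third and
fourth arcs or the second and first. -/
theorem subset_of_planar {p q : ℝ → ℝ → Eucl 3} {S : Set (Eucl 3)} (hpq : p 0 1 = q 0 1)
    (hS : ∀ x ∈ S, ∃ s k, OnArc s k ∧ (x = p s k ∧ m + a * s - b * (1 - k) = 0 ∨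
      x = q s k ∧ m + a * (1 - k) - b * s = 0))
    (hne : m ≠ 0 ∨ a ≠ 0 ∨ b ≠ 0)
    (h3 : ∀ s k, OnArc s k → 0 ≤ m + a * s - b * (1 - k))
    (h4 : ∀ s k, OnArc s k → 0 ≤ m + a * (1 - k) - b * s) :
    (∃ x, S ⊆ {x}) ∨ S ⊆ {p r r, q r r} := by
  rcases planar_cases hne h3 h4 with h | h | ⟨hp, hq⟩ | ⟨-, -, hp, hq⟩
  · by_cases he : m + a * r - b * (1 - r) = 0
    · refine Or.inr fun x hx => ?_
      obtain ⟨s, k, hsk, ⟨rfl, e⟩ | ⟨rfl, e⟩⟩ := hS x hx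
      · obtain ⟨rfl, rfl⟩ := h.third s k hsk e
        simp
      · obtain ⟨rfl, rfl⟩ := h.both he s k hsk e
        simp
    · left
      rcases S.eq_empty_or_nonempty with rfl | ⟨y, hy⟩
      · exact ⟨0, by simp⟩
      refine ⟨y, fun x hx => ?_⟩
      have key : ∀ x ∈ S, ∃ s k, OnArc s k ∧ x = q s k ∧ m + a * (1 - k) - b * s = 0 := by
        intro x hx
        obtain ⟨s, k, hsk, ⟨rfl, e⟩ | ⟨rfl, e⟩⟩ := hS x hx
        · obtain ⟨rfl, rfl⟩ := h.third s k hsk e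
          exact absurd e he
        · exact ⟨s, k, hsk, rfl, e⟩
      obtain ⟨s, k, hsk, rfl, e⟩ := key x hx
      obtain ⟨s', k', hsk', rfl, e'⟩ := key y hy
      obtain ⟨rfl, rfl⟩ := h.fourth s k s' k' hsk hsk' e e'
      rfl
  · by_cases he : m + a * (1 - r) - b * r = 0
    · refine Or.inr fun x hx => ?_
      obtain ⟨s, k, hsk, ⟨rfl, e⟩ | ⟨rfl, e⟩⟩ := hS x hx
      · obtain ⟨rfl, rfl⟩ := h.both (by linarith) s k hsk (by linarith)
        simp
      · obtain ⟨rfl, rfl⟩ := h.third s k hsk (by linarith)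
        simp
    · left
      rcases S.eq_empty_or_nonempty with rfl | ⟨y, hy⟩
      · exact ⟨0, by simp⟩
      refine ⟨y, fun x hx => ?_⟩
      have key : ∀ x ∈ S, ∃ s k, OnArc s k ∧ x = p s k ∧ m + a * s - b * (1 - k) = 0 := by
        intro x hx
        obtain ⟨s, k, hsk, ⟨rfl, e⟩ | ⟨rfl, e⟩⟩ := hS x hx
        · exact ⟨s, k, hsk, rfl, e⟩
        · obtain ⟨rfl, rfl⟩ := h.third s k hsk (by linarith)
          exact absurd e he
      obtain ⟨s, k, hsk, rfl, e⟩ := key x hx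
      obtain ⟨s', k', hsk', rfl, e'⟩ := key y hy
      obtain ⟨rfl, rfl⟩ := h.fourth s k s' k' hsk hsk' (by linarith) (by linarith)
      rfl
  · refine Or.inl ⟨p 0 1, fun x hx => ?_⟩
    obtain ⟨s, k, hsk, ⟨rfl, e⟩ | ⟨rfl, e⟩⟩ := hS x hx
    · obtain ⟨rfl, rfl⟩ := hp s k hsk e
      rfl
    · obtain ⟨rfl, rfl⟩ := hq s k hsk e
      exact hpq.symm
  · refine Or.inl ⟨p r r, fun x hx => ?_⟩
    obtain ⟨s, k, hsk, ⟨rfl, e⟩ | ⟨rfl, e⟩⟩ := hS x hx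
    · obtain ⟨rfl, rfl⟩ := hp s k hsk e
      rfl
    · exact absurd e (hq s k hsk)

/-- The first arc carries no zero, the third at most its end, the second and fourth at most one
each. If the third end is a zero, a zero of the fourth arc must be its end, and if both ends are
zeros, so must a zero of the second. -/
theorem zeros_subset_of_pos (hb : 0 < b) (h : ∀ x ∈ arcs, 0 ≤ val m a b c x) :
    (∃ x y, {x ∈ arcs | val m a b c x = 0} ⊆ {x, y}) ∨
      {x ∈ arcs | val m a b c x = 0} ⊆ {pt₂ r r, pt₃ r r, pt₄ r r} := by
  have h2 : ∀ s k, OnArc s k → 0 ≤ m + b * (1 - k) + c * s := fun s k hsk => by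
    rw [← val_pt₂ m a]; exact h _ (pt₂_mem hsk)
  have h3 : ∀ s k, OnArc s k → 0 ≤ m + a * s - b * (1 - k) := fun s k hsk => by
    rw [← val_pt₃ m a b c]; exact h _ (pt₃_mem hsk)
  have h4 : ∀ s k, OnArc s k → 0 ≤ m + a * (1 - k) - b * s := fun s k hsk => by
    rw [← val_pt₄ m a b c]; exact h _ (pt₄_mem hsk)
  have hP := planarZeros_of_pos hb h3 h4
  obtain ⟨hz1, hz2⟩ := spatialZeros_of_pos hP.pos hb h2
  have hcases : ∀ x ∈ {x ∈ arcs | val m a b c x = 0},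
      (∃ s k, OnArc s k ∧ x = pt₂ s k ∧ m + b * (1 - k) + c * s = 0) ∨
      (x = pt₃ r r ∧ m + a * r - b * (1 - r) = 0) ∨
      (∃ s k, OnArc s k ∧ x = pt₄ s k ∧ m + a * (1 - k) - b * s = 0) := by
    rintro x ⟨hx, e⟩
    obtain ⟨s, k, hsk, rfl | rfl | rfl | rfl⟩ := mem_arcs.1 hx
    · rw [val_pt₁] at e; exact absurd e (hz1 s k hsk)
    · rw [val_pt₂] at e; exact Or.inl ⟨s, k, hsk, rfl, e⟩
    · rw [val_pt₃] at e
      obtain ⟨rfl, rfl⟩ := hP.third s k hsk e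
      exact Or.inr (Or.inl ⟨rfl, e⟩)
    · rw [val_pt₄] at e; exact Or.inr (Or.inr ⟨s, k, hsk, rfl, e⟩)
  have hy : ∃ y, ∀ s k, OnArc s k → m + b * (1 - k) + c * s = 0 → pt₂ s k = y := by
    by_cases hex : ∃ s k, OnArc s k ∧ m + b * (1 - k) + c * s = 0
    · obtain ⟨s, k, hsk, e⟩ := hex
      refine ⟨pt₂ s k, fun s' k' hsk' e' => ?_⟩
      obtain ⟨rfl, rfl⟩ := hz2 s k s' k' hsk hsk' e e'
      rfl
    · exact ⟨0, fun s k hsk e => absurd ⟨s, k, hsk, e⟩ hex⟩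
  obtain ⟨y, hy⟩ := hy
  by_cases e3 : m + a * r - b * (1 - r) = 0
  · by_cases e4 : m + a * (1 - r) - b * r = 0
    · right
      intro x hx
      rcases hcases x hx with ⟨s, k, hsk, rfl, e⟩ | ⟨rfl, e⟩ | ⟨s, k, hsk, rfl, e⟩
      · obtain ⟨rfl, rfl⟩ := second_zero_of_third_fourth hb h2 e3 e4 hsk e
        simp
      · simp
      · obtain ⟨rfl, rfl⟩ := hP.both e3 s k hsk e
        simp
    · left
      refine ⟨y, pt₃ r r, fun x hx => ?_⟩
      rcases hcases x hx with ⟨s, k, hsk, rfl, e⟩ | ⟨rfl, e⟩ | ⟨s, k, hsk, rfl, e⟩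
      · exact Or.inl (hy s k hsk e)
      · simp
      · obtain ⟨rfl, rfl⟩ := hP.both e3 s k hsk e
        exact absurd e e4
  · left
    by_cases hex : ∃ s k, OnArc s k ∧ m + a * (1 - k) - b * s = 0
    · obtain ⟨s', k', hsk', e'⟩ := hex
      refine ⟨y, pt₄ s' k', fun x hx => ?_⟩
      rcases hcases x hx with ⟨s, k, hsk, rfl, e⟩ | ⟨rfl, e⟩ | ⟨s, k, hsk, rfl, e⟩
      · exact Or.inl (hy s k hsk e)
      · exact absurd e e3
      · obtain ⟨rfl, rfl⟩ := hP.fourth s k s' k' hsk hsk' e e'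
        simp
    · refine ⟨y, y, fun x hx => ?_⟩
      rcases hcases x hx with ⟨s, k, hsk, rfl, e⟩ | ⟨rfl, e⟩ | ⟨s, k, hsk, rfl, e⟩
      · exact Or.inl (hy s k hsk e)
      · exact absurd e e3
      · exact absurd ⟨s, k, hsk, e⟩ hex

theorem zero_mem_arc₁ : (0 : Eucl 3) ∈ arc γ₁ :=
  mem_arc₁.2 ⟨0, 1, OnArc.zero_one, pt₁_zero_one.symm⟩

theorem zero_mem_arc₃ : (0 : Eucl 3) ∈ arc γ₃ :=
  mem_arc₃.2 ⟨0, 1, OnArc.zero_one, pt₃_zero_one.symm⟩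

/-- Here `m` is the value at the origin. If `m = 0`, then `a` and `c` are nonnegative, and a
positive one confines the zeros to the plane where its coordinate vanishes. If `m > 0`, only the
ends of the second and third arcs can be zeros. -/
theorem zeros_subset_of_eq_zero (h : ∀ x ∈ arcs, 0 ≤ val m a 0 c x)
    (hne : m ≠ 0 ∨ a ≠ 0 ∨ c ≠ 0) :
    (∃ x y, {x ∈ arcs | val m a 0 c x = 0} ⊆ {x, y}) ∨
      {x ∈ arcs | val m a 0 c x = 0} ⊆ arc γ₃ ∪ arc γ₄ ∨
      {x ∈ arcs | val m a 0 c x = 0} ⊆ arc γ₁ ∪ arc γ₂ := by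
  have h2 := h _ (pt₂_mem OnArc.r_r)
  have h3 := h _ (pt₃_mem OnArc.r_r)
  have hm := h _ (pt₃_mem OnArc.zero_one)
  rw [val_pt₂] at h2
  rw [val_pt₃] at h3 hm
  have hr := r_pos
  have hr2 := half_lt_r
  have hm : 0 ≤ m := by linarith
  rcases hm.eq_or_lt with rfl | hm
  · have ha : 0 ≤ a := by nlinarith
    have hc : 0 ≤ c := by nlinarith
    have zero_of_a : 0 < a → ∀ s k, OnArc s k →
        (val 0 a 0 c (pt₃ s k) = 0 → pt₃ s k = 0) ∧ (val 0 a 0 c (pt₄ s k) = 0 → pt₄ s k = 0) := by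
      intro ha s k hsk
      rw [val_pt₃, val_pt₄]
      constructor <;> intro e
      · obtain ⟨rfl, rfl⟩ := hsk.eq_zero_one_of_left (by nlinarith)
        exact pt₃_zero_one
      · obtain ⟨rfl, rfl⟩ := hsk.eq_zero_one_of_right (by nlinarith)
        exact pt₄_zero_one
    have zero_of_c : 0 < c → ∀ s k, OnArc s k →
        (val 0 a 0 c (pt₁ s k) = 0 → pt₁ s k = 0) ∧ (val 0 a 0 c (pt₂ s k) = 0 → pt₂ s k = 0) := by
      intro hc s k hsk
      rw [val_pt₁, val_pt₂]
      constructor <;> intro e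
      · obtain ⟨rfl, rfl⟩ := hsk.eq_zero_one_of_right (by nlinarith)
        exact pt₁_zero_one
      · obtain ⟨rfl, rfl⟩ := hsk.eq_zero_one_of_left (by nlinarith)
        exact pt₂_zero_one
    rcases ha.eq_or_lt with rfl | ha
    · have hc : 0 < c := lt_of_le_of_ne hc (by simpa [eq_comm] using hne)
      right; left
      rintro x ⟨hx, e⟩
      obtain ⟨s, k, hsk, rfl | rfl | rfl | rfl⟩ := mem_arcs.1 hx
      · rw [(zero_of_c hc s k hsk).1 e]; exact Or.inl zero_mem_arc₃
      · rw [(zero_of_c hc s k hsk).2 e]; exact Or.inl zero_mem_arc₃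
      · exact Or.inl (mem_arc₃.2 ⟨s, k, hsk, rfl⟩)
      · exact Or.inr (mem_arc₄.2 ⟨s, k, hsk, rfl⟩)
    · right; right
      rintro x ⟨hx, e⟩
      obtain ⟨s, k, hsk, rfl | rfl | rfl | rfl⟩ := mem_arcs.1 hx
      · exact Or.inl (mem_arc₁.2 ⟨s, k, hsk, rfl⟩)
      · exact Or.inr (mem_arc₂.2 ⟨s, k, hsk, rfl⟩)
      · rw [(zero_of_a ha s k hsk).1 e]; exact Or.inl zero_mem_arc₁
      · rw [(zero_of_a ha s k hsk).2 e]; exact Or.inl zero_mem_arc₁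
  · refine Or.inl ⟨pt₂ r r, pt₃ r r, ?_⟩
    rintro x ⟨hx, e⟩
    obtain ⟨s, k, hsk, rfl | rfl | rfl | rfl⟩ := mem_arcs.1 hx
    · rw [val_pt₁] at e
      nlinarith [hsk.r_le, hsk.le_one]
    · rw [val_pt₂] at e
      obtain ⟨rfl, rfl⟩ := hsk.eq_r (by nlinarith [hsk.nonneg])
      simp
    · rw [val_pt₃] at e
      obtain ⟨rfl, rfl⟩ := hsk.eq_r (by nlinarith [hsk.nonneg])
      simp
    · rw [val_pt₄] at e
      nlinarith [hsk.r_le, hsk.le_one]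

theorem zeros_subset (h : ∀ x ∈ arcs, 0 ≤ val m a b c x)
    (hne : m ≠ 0 ∨ a ≠ 0 ∨ b ≠ 0 ∨ c ≠ 0) :
    (∃ x y, {x ∈ arcs | val m a b c x = 0} ⊆ {x, y}) ∨
      {x ∈ arcs | val m a b c x = 0} ⊆ {pt₂ r r, pt₃ r r, pt₄ r r} ∨
      {x ∈ arcs | val m a b c x = 0} ⊆ {pt₃ r r, pt₂ r r, pt₁ r r} ∨
      {x ∈ arcs | val m a b c x = 0} ⊆ arc γ₃ ∪ arc γ₄ ∨
      {x ∈ arcs | val m a b c x = 0} ⊆ arc γ₁ ∪ arc γ₂ := by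
  rcases lt_trichotomy b 0 with hb | rfl | hb
  · have h' : ∀ x ∈ arcs, 0 ≤ val m c (-b) a x := fun x hx => by
      rw [← val_swap]; exact h _ (swap_mem_arcs hx)
    have hmem : ∀ x ∈ {x ∈ arcs | val m a b c x = 0},
        swap x ∈ {x ∈ arcs | val m c (-b) a x = 0} := by
      rintro x ⟨hx, e⟩
      exact ⟨swap_mem_arcs hx, by rwa [← val_swap, swap_swap]⟩
    rcases zeros_subset_of_pos (neg_pos.2 hb) h' with ⟨x, y, hxy⟩ | hT
    · refine Or.inl ⟨swap x, swap y, fun z hz => ?_⟩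
      simpa [swap_eq_iff] using hxy (hmem z hz)
    · refine Or.inr (Or.inr (Or.inl fun z hz => ?_))
      simpa [swap_eq_iff, swap_pt₂, swap_pt₃, swap_pt₄] using hT (hmem z hz)
  · rcases zeros_subset_of_eq_zero h (by simpa using hne) with h | h | h
    · exact Or.inl h
    · exact Or.inr (Or.inr (Or.inr (Or.inl h)))
    · exact Or.inr (Or.inr (Or.inr (Or.inr h)))
  · rcases zeros_subset_of_pos hb h with h | h
    · exact Or.inl h
    · exact Or.inr (Or.inl h)

end

/-! ### Cones generated by compact sets -/

section

variable {V : Type*} [NormedAddCommGroup V] [InnerProductSpace ℝ V]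

theorem hull_convexHull (G : Set V) :
    PointedCone.hull ℝ (convexHull ℝ G) = PointedCone.hull ℝ G :=
  le_antisymm (Submodule.span_le.2 (convexHull_min Submodule.subset_span (PointedCone.convex _)))
    (Submodule.span_mono (subset_convexHull ℝ G))

theorem mem_hull_iff_of_convex {B : Set V} (hB : Convex ℝ B) (hne : B.Nonempty) {x : V} :
    x ∈ PointedCone.hull ℝ B ↔ ∃ t : ℝ, 0 ≤ t ∧ ∃ y ∈ B, t • y = x := by
  constructor
  · intro hx
    induction hx using Submodule.span_induction with
    | mem x h => exact ⟨1, zero_le_one, x, h, one_smul _ _⟩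
    | zero => exact ⟨0, le_rfl, hne.some, hne.some_mem, zero_smul _ _⟩
    | add x y _ _ ihx ihy =>
      obtain ⟨t, ht, x, hx, rfl⟩ := ihx
      obtain ⟨t', ht', y, hy, rfl⟩ := ihy
      rcases (add_nonneg ht ht').eq_or_lt with h0 | h0
      · have h1 : t = 0 := by linarith
        have h2 : t' = 0 := by linarith
        exact ⟨0, le_rfl, x, hx, by simp [h1, h2]⟩
      · refine ⟨t + t', h0.le, (t / (t + t')) • x + (t' / (t + t')) • y,
          hB hx hy (by positivity) (by positivity) (by field_simp), ?_⟩
        rw [smul_add, smul_smul, smul_smul, mul_div_cancel₀ _ h0.ne', mul_div_cancel₀ _ h0.ne']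
    | smul c x _ ih =>
      obtain ⟨t, ht, x, hx, rfl⟩ := ih
      exact ⟨c * t, mul_nonneg c.2 ht, x, hx, mul_smul (c : ℝ) t x⟩
  · rintro ⟨t, ht, y, hy, rfl⟩
    exact smul_mem_pointedCone _ ht (Submodule.subset_span hy)

/-- The cone generated by a compact subset of an affine hyperplane off the origin is closed. -/
theorem isClosed_hull_of_isCompact [FiniteDimensional ℝ V] {G : Set V} (hG : IsCompact G)
    (hne : G.Nonempty) {v : V} (hv : ∀ g ∈ G, inner ℝ v g = 1) :
    IsClosed (PointedCone.hull ℝ G : Set V) := by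
  rw [← hull_convexHull]
  set B := convexHull ℝ G with hBdef
  have hBc : IsCompact B := isCompact_convexHull_of_finiteDimensional hG
  have hB : Convex ℝ B := convex_convexHull ℝ G
  have hvB : ∀ y ∈ B, inner ℝ v y = 1 := by
    have hconv : Convex ℝ {y | inner ℝ v y = (1 : ℝ)} := by
      intro x hx y hy a b _ _ hab
      simp only [Set.mem_ofPred_eq] at hx hy ⊢
      rw [inner_add_right, inner_smul_right, inner_smul_right, hx, hy]
      linarith
    exact fun y hy => convexHull_min hv hconv hy
  refine isClosed_of_closure_subset fun x hx => ?_
  -- Only the part of the cone below height `M` matters near `x`, and it lies in a compact subset of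
  -- the cone.
  let M := inner ℝ v x + 1
  have hcomp : IsCompact ((fun p : ℝ × V => p.1 • p.2) '' (Set.Icc 0 M ×ˢ B)) :=
    (isCompact_Icc.prod hBc).image (by fun_prop)
  have hopen : IsOpen {y : V | inner ℝ v y < M} :=
    isOpen_lt (by fun_prop) continuous_const
  have hsub : {y : V | inner ℝ v y < M} ∩ (PointedCone.hull ℝ B : Set V) ⊆
      (fun p : ℝ × V => p.1 • p.2) '' (Set.Icc 0 M ×ˢ B) := by
    rintro y ⟨hyM, hy⟩
    obtain ⟨t, ht, z, hz, rfl⟩ := (mem_hull_iff_of_convex hB hne.convexHull).1 hy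
    refine ⟨(t, z), ⟨⟨ht, ?_⟩, hz⟩, rfl⟩
    simp only [Set.mem_ofPred_eq, inner_smul_right, hvB z hz, mul_one] at hyM
    exact hyM.le
  have hxM : x ∈ {y : V | inner ℝ v y < M} := by simp [M]
  have hx' := hopen.inter_closure ⟨hxM, hx⟩
  obtain ⟨⟨t, z⟩, ⟨⟨ht, -⟩, hz⟩, rfl⟩ := closure_minimal hsub hcomp.isClosed hx'
  exact smul_mem_pointedCone _ ht (Submodule.subset_span hz)

theorem inner_eq_zero_of_mem_hull {G : Set V} {v : V} (hv : ∀ g ∈ G, inner ℝ v g = 0) {x : V}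
    (hx : x ∈ PointedCone.hull ℝ G) : inner ℝ v x = 0 := by
  refine le_antisymm ?_ (inner_nonneg_of_mem_hull (fun g hg => (hv g hg).ge) hx)
  have := inner_nonneg_of_mem_hull (v := -v) (fun g hg => by simp [hv g hg]) hx
  rw [inner_neg_left] at this
  linarith

end

/-! ### The cone in coordinates -/

/-- The generator of the cone corresponding to a point of `ℝ³`. -/
def gen (x : Eucl 3) : Eucl 4 := lift (dilate x)

theorem gen_eq (x : Eucl 3) : gen x = !₂[1, 2 * x 0 + 1 / 2, 2 * x 1, 2 * x 2 + 1 / 2] := by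
  ext i; fin_cases i <;> simp [gen, lift, dilate]

theorem continuous_gen : Continuous gen := by
  rw [show gen = fun x => !₂[1, 2 * x 0 + 1 / 2, 2 * x 1, 2 * x 2 + 1 / 2] from funext gen_eq]
  refine (PiLp.continuous_toLp 2 _).comp (continuous_pi fun i => ?_)
  fin_cases i <;> simp <;> fun_prop

theorem gen_combo {x y : Eucl 3} {a b : ℝ} (hab : a + b = 1) :
    gen (a • x + b • y) = a • gen x + b • gen y := by
  rw [gen_eq, gen_eq, gen_eq]
  ext i
  fin_cases i
  · simp [hab]
  · simp; linear_combination (-1 / 2 : ℝ) * hab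
  · simp; ring
  · simp; linear_combination (-1 / 2 : ℝ) * hab

/-- The vector of `ℝ⁴` representing the affine functional `val m a b c`. -/
def vec (m a b c : ℝ) : Eucl 4 := !₂[m + (a + c) / 4, -a / 2, -b / 2, -c / 2]

/-- The entries of `vec` undo the dilation and the shift, so supporting hyperplanes of the cone can
be studied on the original arcs. -/
theorem inner_vec_gen (m a b c : ℝ) (x : Eucl 3) :
    inner ℝ (vec m a b c) (gen x) = val m a b c x := by
  rw [gen_eq]
  simp [vec, val, PiLp.inner_apply, Fin.sum_univ_four]
  ring

theorem exists_eq_vec (v : Eucl 4) : ∃ m a b c, v = vec m a b c := by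
  refine ⟨v 0 + (v 1 + v 3) / 2, -2 * v 1, -2 * v 2, -2 * v 3, ?_⟩
  ext i; fin_cases i <;> simp [vec]; ring

theorem homogenization_convexHull (A : Set (Eucl 3)) :
    homogenization (dilate '' convexHull ℝ A) = PointedCone.hull ℝ (gen '' A) := by
  rw [homogenization, ← Set.image_comp]
  refine le_antisymm (Submodule.span_le.2 ?_)
    (Submodule.span_mono (Set.image_mono (subset_convexHull ℝ A)))
  rw [Set.image_subset_iff]
  refine convexHull_min (fun x hx => Submodule.subset_span ⟨x, hx, rfl⟩) ?_
  intro x hx y hy a b ha hb hab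
  change gen (a • x + b • y) ∈ PointedCone.hull ℝ (gen '' A)
  rw [gen_combo hab]
  exact (PointedCone.convex _) hx hy ha hb hab

theorem coneK_eq : coneK = PointedCone.hull ℝ (gen '' arcs) := homogenization_convexHull _

theorem faceF_eq : faceF = PointedCone.hull ℝ (gen '' (arc γ₃ ∪ arc γ₄)) :=
  homogenization_convexHull _

theorem arc₃_union_arc₄_subset : arc γ₃ ∪ arc γ₄ ⊆ arcs := by
  rintro x (hx | hx)
  · exact Or.inl (Or.inr hx)
  · exact Or.inr hx

theorem arc₁_union_arc₂_subset : arc γ₁ ∪ arc γ₂ ⊆ arcs := fun _ hx => Or.inl (Or.inl hx)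

theorem isCompact_arcs : IsCompact arcs := by
  have key : ∀ γ : ℝ → Eucl 3, Continuous γ → IsCompact (arc γ) := fun γ h =>
    isCompact_Icc.image h
  refine (((key _ ?_).union (key _ ?_)).union (key _ ?_)).union (key _ ?_) <;>
  · refine (PiLp.continuous_toLp 2 _).comp (continuous_pi fun i => ?_)
    fin_cases i <;> simp <;> fun_prop

theorem isClosed_coneK : IsClosed (coneK : Set (Eucl 4)) := by
  rw [coneK_eq]
  refine isClosed_hull_of_isCompact (isCompact_arcs.image continuous_gen)
    (v := vec 1 0 0 0) ⟨_, _, pt₁_mem OnArc.zero_one, rfl⟩ ?_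
  rintro _ ⟨x, -, rfl⟩
  rw [inner_vec_gen]
  simp [val]

/-- The functional -z exposes `F`: on the first two arcs it vanishes only at the origin, which is
also the start of the third arc. -/
theorem isFace_faceF : IsFace (faceF : Set (Eucl 4)) (coneK : Set (Eucl 4)) := by
  have hv : ∀ g ∈ gen '' arcs, 0 ≤ inner ℝ (vec 0 0 0 1) g := by
    rintro _ ⟨x, hx, rfl⟩
    rw [inner_vec_gen]
    obtain ⟨s, k, h, rfl | rfl | rfl | rfl⟩ := mem_arcs.1 hx
    · rw [val_pt₁]; linarith [h.le_one]
    · rw [val_pt₂]; linarith [h.nonneg]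
    · rw [val_pt₃]; linarith
    · rw [val_pt₄]; linarith
  have hF : (faceF : Set (Eucl 4)) =
      {x | x ∈ PointedCone.hull ℝ (gen '' arcs) ∧ inner ℝ (vec 0 0 0 1) x = 0} := by
    rw [zero_set_eq_hull hv, faceF_eq]
    congr 2
    ext g
    constructor
    · rintro ⟨x, hx, rfl⟩
      refine ⟨⟨x, arc₃_union_arc₄_subset hx, rfl⟩, ?_⟩
      rw [inner_vec_gen]
      rcases hx with hx | hx
      · obtain ⟨s, k, -, rfl⟩ := mem_arc₃.1 hx
        rw [val_pt₃]; ring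
      · obtain ⟨s, k, -, rfl⟩ := mem_arc₄.1 hx
        rw [val_pt₄]; ring
    · rintro ⟨⟨x, hx, rfl⟩, e⟩
      rw [inner_vec_gen] at e
      obtain ⟨s, k, h, rfl | rfl | rfl | rfl⟩ := mem_arcs.1 hx
      · rw [val_pt₁] at e
        obtain ⟨rfl, rfl⟩ := h.eq_zero_one_of_right (by linarith)
        exact ⟨_, Or.inl zero_mem_arc₃, by rw [pt₁_zero_one]⟩
      · rw [val_pt₂] at e
        obtain ⟨rfl, rfl⟩ := h.eq_zero_one_of_left (by linarith)
        exact ⟨_, Or.inl zero_mem_arc₃, by rw [pt₂_zero_one]⟩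
      · exact ⟨_, Or.inl (mem_arc₃.2 ⟨s, k, h, rfl⟩), rfl⟩
      · exact ⟨_, Or.inr (mem_arc₄.2 ⟨s, k, h, rfl⟩), rfl⟩
  rw [hF, coneK_eq]
  have hexp := isExposed_inner_eq_zero hv
  exact ⟨⟨0, zero_mem _, by simp⟩, hexp.convex (PointedCone.convex _), hexp.isExtreme⟩

/-! ### Facial exposedness -/

section

variable {E : Set (Eucl 4)}

theorem face_subset_hull {A B : Set (Eucl 3)}
    (hE : IsFace E (PointedCone.hull ℝ (gen '' A) : Set (Eucl 4)))
    (hB : ∀ x ∈ A, gen x ∈ E → x ∈ B) :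
    E ⊆ (PointedCone.hull ℝ (gen '' B) : Set (Eucl 4)) := by
  rw [face_eq_hull_inter hE.isExtreme hE.nonempty hE.convex]
  refine Submodule.span_mono ?_
  rintro _ ⟨⟨x, hx, rfl⟩, hxE⟩
  exact ⟨x, hB x hx hxE, rfl⟩

theorem exists_functional_of_face_ne {A : Set (Eucl 3)}
    (hE : IsFace E (PointedCone.hull ℝ (gen '' A) : Set (Eucl 4)))
    (hne : E ≠ (PointedCone.hull ℝ (gen '' A) : Set (Eucl 4))) :
    ∃ m a b c : ℝ, (∀ x ∈ A, 0 ≤ val m a b c x) ∧ (∀ x, gen x ∈ E → val m a b c x = 0) ∧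
      ∃ x ∈ A, val m a b c x ≠ 0 := by
  obtain ⟨v, hv, hvE, y, hy, hvy⟩ :=
    exists_supporting_of_face_ne hE.isExtreme hE.nonempty hE.convex hne
  obtain ⟨m, a, b, c, rfl⟩ := exists_eq_vec v
  refine ⟨m, a, b, c, fun x hx => ?_, fun x hx => ?_, ?_⟩
  · rw [← inner_vec_gen]
    exact hv _ (Submodule.subset_span ⟨x, hx, rfl⟩)
  · rw [← inner_vec_gen]
    exact hvE _ hx
  · by_contra! h
    refine hvy (inner_eq_zero_of_mem_hull ?_ hy)
    rintro _ ⟨x, hx, rfl⟩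
    rw [inner_vec_gen, h x hx]

/-- A face of the cone all of whose generators lie on two coplanar arcs. -/
theorem isZeroSet_of_subset_planar {p q : ℝ → ℝ → Eucl 3} {A : Set (Eucl 3)} (hA : A ⊆ arcs)
    (hAp : ∀ x, x ∈ A ↔ ∃ s k, OnArc s k ∧ (x = p s k ∨ x = q s k)) (hpq : p 0 1 = q 0 1)
    (hval : ∀ m a b c, ∃ a' b', (∀ s k, val m a b c (p s k) = m + a' * s - b' * (1 - k)) ∧
      ∀ s k, val m a b c (q s k) = m + a' * (1 - k) - b' * s)
    (hAz : IsZeroSet A) (hpair : IsZeroSet {p r r, q r r})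
    (hE : IsFace E (PointedCone.hull ℝ (gen '' arcs) : Set (Eucl 4)))
    (hEA : ∀ x ∈ arcs, gen x ∈ E → x ∈ A) : IsZeroSet {x ∈ arcs | gen x ∈ E} := by
  have hsub := face_subset_hull hE hEA
  have hle : PointedCone.hull ℝ (gen '' A) ≤ PointedCone.hull ℝ (gen '' arcs) :=
    Submodule.span_mono (Set.image_mono hA)
  -- Extremality passes to the planar subcone, where a proper face has a supporting functional that
  -- does not vanish on the whole plane.
  have hE' : IsFace E (PointedCone.hull ℝ (gen '' A) : Set (Eucl 4)) :=
    ⟨hE.nonempty, hE.convex, hE.isExtreme.mono hle hsub⟩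
  have hSarcs : {x ∈ arcs | gen x ∈ E} ⊆ arcs := fun x hx => hx.1
  by_cases heq : E = (PointedCone.hull ℝ (gen '' A) : Set (Eucl 4))
  · convert hAz using 1
    ext x
    refine ⟨fun hx => hEA x hx.1 hx.2, fun hx => ⟨hA hx, ?_⟩⟩
    rw [heq]
    exact Submodule.subset_span ⟨x, hx, rfl⟩
  · obtain ⟨m, a, b, c, hnn, hz, x, hx, hne⟩ := exists_functional_of_face_ne hE' heq
    obtain ⟨a', b', hp, hq⟩ := hval m a b c
    have hres := subset_of_planar (m := m) (a := a') (b := b') (p := p) (q := q)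
      (S := {x ∈ arcs | gen x ∈ E}) hpq ?_ ?_ ?_ ?_
    · rcases hres with ⟨y, hy⟩ | hy
      · exact isZeroSet_of_subset_singleton hSarcs hy
      · exact isZeroSet_of_subset_pair hSarcs hy fun _ _ => hpair
    · rintro y ⟨hy, hyE⟩
      obtain ⟨s, k, h, rfl | rfl⟩ := (hAp y).1 (hEA y hy hyE)
      · exact ⟨s, k, h, Or.inl ⟨rfl, by rw [← hp]; exact hz _ hyE⟩⟩
      · exact ⟨s, k, h, Or.inr ⟨rfl, by rw [← hq]; exact hz _ hyE⟩⟩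
    · by_contra! h0
      obtain ⟨rfl, rfl, rfl⟩ := h0
      obtain ⟨s, k, h, rfl | rfl⟩ := (hAp x).1 hx
      · exact hne (by rw [hp]; ring)
      · exact hne (by rw [hq]; ring)
    · intro s k h
      rw [← hp]
      exact hnn _ ((hAp _).2 ⟨s, k, h, Or.inl rfl⟩)
    · intro s k h
      rw [← hq]
      exact hnn _ ((hAp _).2 ⟨s, k, h, Or.inr rfl⟩)

theorem isZeroSet_of_isFace (hE : IsFace E (PointedCone.hull ℝ (gen '' arcs) : Set (Eucl 4)))
    (hne : E ≠ (PointedCone.hull ℝ (gen '' arcs) : Set (Eucl 4))) :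
    IsZeroSet {x ∈ arcs | gen x ∈ E} := by
  obtain ⟨m, a, b, c, hnn, hz, x, hx, hx0⟩ := exists_functional_of_face_ne hE hne
  set S := {x ∈ arcs | gen x ∈ E} with hS
  set Z := {x ∈ arcs | val m a b c x = 0} with hZ
  have hSarcs : S ⊆ arcs := fun x hx => hx.1
  have hSZ : S ⊆ Z := fun x hx => ⟨hx.1, hz x hx.2⟩
  have hZz : IsZeroSet Z := ⟨m, a, b, c, fun x hx => ⟨hnn x hx, fun h => ⟨hx, h⟩, fun h => h.2⟩⟩
  have h0 : m ≠ 0 ∨ a ≠ 0 ∨ b ≠ 0 ∨ c ≠ 0 := by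
    by_contra! h0
    obtain ⟨rfl, rfl, rfl, rfl⟩ := h0
    exact hx0 (by simp [val])
  rcases zeros_subset hnn h0 with ⟨x, y, hxy⟩ | hT | hT | hP | hP
  · refine isZeroSet_of_subset_pair hSarcs (hSZ.trans hxy) fun hx hy => ?_
    -- When the face contains both points, the hyperplane already found cuts out exactly this pair.
    have : {x, y} = Z := Set.Subset.antisymm
      (by rintro w (rfl | rfl); exacts [hSZ hx, hSZ hy]) hxy
    rwa [this]
  · exact isZeroSet_of_subset_triple hSarcs hSZ hZz hT isZeroSet_ends₂₃ isZeroSet_ends₂₄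
      isZeroSet_ends₃₄
  · exact isZeroSet_of_subset_triple hSarcs hSZ hZz hT (Set.pair_comm _ _ ▸ isZeroSet_ends₂₃)
      isZeroSet_ends₃₁ isZeroSet_ends₂₁
  · refine isZeroSet_of_subset_planar (p := pt₃) (q := pt₄) arc₃_union_arc₄_subset (fun x => ?_)
      (by rw [pt₃_zero_one, pt₄_zero_one])
      (fun m a b c => ⟨a, b, fun s k => val_pt₃ .., fun s k => val_pt₄ ..⟩)
      isZeroSet_arc₃_union_arc₄ isZeroSet_ends₃₄ hE fun x hx hxE => hP (hSZ ⟨hx, hxE⟩)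
    simp only [Set.mem_union, mem_arc₃, mem_arc₄, ← exists_or, and_or_left]
  · refine isZeroSet_of_subset_planar (p := pt₂) (q := pt₁) arc₁_union_arc₂_subset (fun x => ?_)
      (by rw [pt₂_zero_one, pt₁_zero_one])
      (fun m a b c => ⟨c, -b, fun s k => by rw [val_pt₂]; ring, fun s k => by rw [val_pt₁]; ring⟩)
      isZeroSet_arc₁_union_arc₂ isZeroSet_ends₂₁ hE fun x hx hxE => hP (hSZ ⟨hx, hxE⟩)
    simp only [Set.mem_union, mem_arc₁, mem_arc₂, ← exists_or, and_or_left]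
    simp only [or_comm]

end

theorem isFaciallyExposed_coneK : IsFaciallyExposed (coneK : Set (Eucl 4)) := by
  intro E hE
  rw [coneK_eq] at hE ⊢
  by_cases hne : E = (PointedCone.hull ℝ (gen '' arcs) : Set (Eucl 4))
  · rw [hne]
  obtain ⟨m, a, b, c, h⟩ := isZeroSet_of_isFace hE hne
  refine isExposed_of_inner_eq_zero_iff (v := vec m a b c) hE.isExtreme hE.nonempty hE.convex
    ?_ ?_
  · rintro _ ⟨x, hx, rfl⟩
    rw [inner_vec_gen]
    exact (h x hx).1
  · rintro _ ⟨x, hx, rfl⟩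
    rw [inner_vec_gen, (h x hx).2]
    exact ⟨fun h => h.2, fun h => ⟨hx, h⟩⟩

/-! ### The sum `K* + F^⊥` is not closed -/

/-- The functional δ + y is negative on part of the first arc when δ is small. Subtracting a
multiple of z, which vanishes on `F`, makes it nonnegative on all arcs. -/
theorem mem_dualAddPerp {δ : ℝ} (hδ : 0 < δ) :
    vec δ 0 (-1) 0 ∈ dualAddPerp (coneK : Set (Eucl 4)) (faceF : Set (Eucl 4)) := by
  -- The term `1 / δ` completes the square on the first arc; the term 1 suffices on the second,
  -- where `1 - k ≤ s`.
  let M := 1 + 1 / δ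
  have hM : 1 ≤ M := by have : 0 < 1 / δ := by positivity
                        simp only [M]; linarith
  refine ⟨vec δ 0 (-1) M, ?_, vec 0 0 0 (-M), ?_, ?_⟩
  · rw [SetLike.mem_coe, ProperCone.mem_innerDual]
    intro x hx
    rw [real_inner_comm]
    rw [coneK_eq] at hx
    refine inner_nonneg_of_mem_hull ?_ hx
    rintro _ ⟨x, hx, rfl⟩
    rw [inner_vec_gen]
    obtain ⟨s, k, h, rfl | rfl | rfl | rfl⟩ := mem_arcs.1 hx
    · rw [val_pt₁]
      have h1 : M * (s ^ 2 / 2) ≤ M * (1 - k) :=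
        mul_le_mul_of_nonneg_left h.half_sq_le_one_sub (by linarith)
      have h2 : δ - s + M * (s ^ 2 / 2) = ((δ - s) ^ 2 + δ ^ 2 + δ * s ^ 2) / (2 * δ) := by
        simp only [M]; field_simp; ring
      have h3 : 0 ≤ ((δ - s) ^ 2 + δ ^ 2 + δ * s ^ 2) / (2 * δ) := by positivity
      linarith
    · rw [val_pt₂]
      nlinarith [h.one_le_add, h.nonneg]
    · rw [val_pt₃]; linarith [h.le_one]
    · rw [val_pt₄]; linarith [h.nonneg]
  · rw [SetLike.mem_coe, Submodule.mem_orthogonal']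
    intro u hu
    have hle : Submodule.span ℝ (faceF : Set (Eucl 4)) ≤
        LinearMap.ker (innerₗ (Eucl 4) (vec 0 0 0 (-M))) := by
      refine Submodule.span_le.2 fun x hx => ?_
      rw [faceF_eq] at hx
      refine inner_eq_zero_of_mem_hull ?_ hx
      rintro _ ⟨x, hx | hx, rfl⟩
      · obtain ⟨s, k, -, rfl⟩ := mem_arc₃.1 hx
        rw [inner_vec_gen, val_pt₃]; ring
      · obtain ⟨s, k, -, rfl⟩ := mem_arc₄.1 hx
        rw [inner_vec_gen, val_pt₄]; ring
    exact hle hu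
  · ext i; fin_cases i <;> simp [vec] <;> ring

/-- Agreement with y on `F` fixes `m = 0` and `b = -1`, and no choice of `c` offsets the linear
descent along the first arc. -/
theorem notMem_dualAddPerp :
    vec 0 0 (-1) 0 ∉ dualAddPerp (coneK : Set (Eucl 4)) (faceF : Set (Eucl 4)) := by
  rintro ⟨y, hy, w, hw, hyw⟩
  obtain ⟨m, a, b, c, rfl⟩ := exists_eq_vec y
  have hy' : ∀ x ∈ arcs, 0 ≤ val m a b c x := by
    intro x hx
    rw [← inner_vec_gen, real_inner_comm]
    refine ProperCone.mem_innerDual.1 hy ?_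
    rw [coneK_eq]
    exact Submodule.subset_span ⟨x, hx, rfl⟩
  have heq : ∀ x ∈ arc γ₃ ∪ arc γ₄, val m a b c x = val 0 0 (-1) 0 x := by
    intro x hx
    have hgen : gen x ∈ Submodule.span ℝ (faceF : Set (Eucl 4)) := by
      rw [faceF_eq]
      exact Submodule.subset_span (Submodule.subset_span ⟨x, hx, rfl⟩)
    have h0 : inner ℝ w (gen x) = 0 := (Submodule.mem_orthogonal' _ _).1 hw _ hgen
    rw [← inner_vec_gen, ← inner_vec_gen, ← hyw, inner_add_left, h0, add_zero]
  have h0 := heq _ (Or.inl (mem_arc₃.2 ⟨_, _, OnArc.zero_one, rfl⟩))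
  have h3 := heq _ (Or.inl (mem_arc₃.2 ⟨_, _, OnArc.r_r, rfl⟩))
  have h4 := heq _ (Or.inr (mem_arc₄.2 ⟨_, _, OnArc.r_r, rfl⟩))
  rw [val_pt₃, val_pt₃] at h0 h3
  rw [val_pt₄, val_pt₄] at h4
  have hr := half_lt_r
  have hrr := r_sq
  have hm : m = 0 := by linarith
  subst hm
  -- The combination of the two end conditions eliminates `a`, leaving the nonzero factor `r ^ 2 -
  -- (1 - r) ^ 2 = 2 * r - 1`.
  have hb : b = -1 := by
    have : (b + 1) * (2 * r - 1) = 0 := by linear_combination (-r) * h4 + (1 - r) * h3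
    rcases mul_eq_zero.1 this with h | h <;> linarith
  subst hb
  refine lt_irrefl (0 : ℝ) (pos_of_nonneg_on_arc (a := c) zero_lt_one fun s k h => ?_)
  have := hy' _ (pt₁_mem h)
  rw [val_pt₁] at this
  linarith

theorem not_isClosed_dualAddPerp :
    ¬ IsClosed (dualAddPerp (coneK : Set (Eucl 4)) (faceF : Set (Eucl 4))) := by
  intro hcl
  refine notMem_dualAddPerp ?_
  have hcont : Continuous fun δ : ℝ => vec δ 0 (-1) 0 := by
    refine (PiLp.continuous_toLp 2 _).comp (continuous_pi fun i => ?_)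
    fin_cases i <;> simp <;> fun_prop
  have hlim : Filter.Tendsto (fun δ : ℝ => vec δ 0 (-1) 0) (nhdsWithin 0 (Set.Ioi 0))
      (nhds (vec 0 0 (-1) 0)) := (hcont.tendsto 0).mono_left nhdsWithin_le_nhds
  exact hcl.mem_of_tendsto hlim
    (Filter.eventually_of_mem self_mem_nhdsWithin fun δ hδ => mem_dualAddPerp hδ)

end PatakiCounterexample

end

/-- The explicit closed convex cone `K ⊆ ℝ⁴` is facially exposed, `F` is a face of it and
`K* + F^⊥` is not closed, so `K` is not nice; hence not every facially exposed closed convex cone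
in a Euclidean space is nice. -/
theorem theorem4 :
    (IsClosed (PatakiCounterexample.coneK : Set (PatakiCounterexample.Eucl 4)) ∧
      PatakiCounterexample.IsFaciallyExposed
        (PatakiCounterexample.coneK : Set (PatakiCounterexample.Eucl 4)) ∧
      PatakiCounterexample.IsFace
        (PatakiCounterexample.faceF : Set (PatakiCounterexample.Eucl 4))
        (PatakiCounterexample.coneK : Set (PatakiCounterexample.Eucl 4)) ∧
      ¬ IsClosed (PatakiCounterexample.dualAddPerp
        (PatakiCounterexample.coneK : Set (PatakiCounterexample.Eucl 4))
        (PatakiCounterexample.faceF : Set (PatakiCounterexample.Eucl 4))) ∧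
      ¬ PatakiCounterexample.IsNice
        (PatakiCounterexample.coneK : Set (PatakiCounterexample.Eucl 4))) ∧
    ¬ ∀ (n : ℕ) (K : PointedCone ℝ (PatakiCounterexample.Eucl n)),
      IsClosed (K : Set (PatakiCounterexample.Eucl n)) →
      PatakiCounterexample.IsFaciallyExposed (K : Set (PatakiCounterexample.Eucl n)) →
      PatakiCounterexample.IsNice (K : Set (PatakiCounterexample.Eucl n)) := by
  have hnice : ¬ PatakiCounterexample.IsNice
      (PatakiCounterexample.coneK : Set (PatakiCounterexample.Eucl 4)) := fun h =>
    PatakiCounterexample.not_isClosed_dualAddPerp (h _ PatakiCounterexample.isFace_faceF)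
  exact ⟨⟨PatakiCounterexample.isClosed_coneK, PatakiCounterexample.isFaciallyExposed_coneK,
    PatakiCounterexample.isFace_faceF, PatakiCounterexample.not_isClosed_dualAddPerp, hnice⟩,
    fun h => hnice (h 4 _ PatakiCounterexample.isClosed_coneK
      PatakiCounterexample.isFaciallyExposed_coneK)⟩
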